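/- Let $\mathcal A_3=\mathbb Z[x]/(x^3)$, graded by $\deg x^d=d$. For a finite simple graph $G$ with a fixed ordering of its edges, and $s\subseteq E(G)$, let $[G:s]$ be the spanning subgraph of $G$ with edge set $s$, and let $k(s)$ be its number of connected components. The chromatic graph cochain complex of $G$ over $\mathcal A_3$ is $C^i(G)=\bigoplus_{|s|=i}\mathcal A_3^{\otimes k(s)}$ (tensor products over $\mathbb Z$, one factor for each component of $[G:s]$), with differential $d^i=\sum_{e\notin s}(-1)^{t(s,e)}d_e:C^i(G)\to C^{i+1}(G)$ on the summand of $s$. Here $t(s,e)$ is the number of edges of $s$ which precede $e$, and $d_e$ maps the summand of $s$ to the summand of $s\cup\{e\}$: if $e$ joins two different components of $[G:s]$, then $d_e$ multiplies the two corresponding tensor factors, and otherwise $d_e$ is the identity. The differential preserves the total degree $j$ in $x$. Let $C^{i,j}(G)\subseteq C^i(G)$ be the part of total degree $j$, and let $H^{i,j}_{\mathcal A_3}(G)$ be the $i$-th cohomology group of the complex $(C^{*,j}(G),d)$. **Corollary 4.9.** For the complete graph $K_n$ with $n\ge 4$ vertices and any ordering of its edges, there is an isomorphism of abelian groups $$H^{1,2n-3}_{\mathcal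 A_3}(K_n)\;\cong\;\mathbb Z_2\oplus\mathbb Z_3^{\,n-1}\oplus\mathbb Z^{\,n(n-1)(2n-7)/6},$$ where $\mathbb Z_q=\mathbb Z/q\mathbb Z$. -/

import Mathlib

open scoped TensorProduct

noncomputable section

namespace ChromaticCohomology

/-! ### Multiplying together the factors of a tensor power along a map of index sets -/

section Merge

variable (k A : Type) [CommRing k] [CommRing A] [Algebra k A]
variable {ι κ μ : Type} [Fintype ι] [DecidableEq κ]

theorem fiberProd_update [DecidableEq ι] (f : ι → κ) (a : ι → A) (i : ι) (x : A) :
    (fun c' => ∏ c with f c = c', Function.update a i x c) =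
      Function.update (fun c' => ∏ c with f c = c', a c) (f i)
        (x * ∏ c ∈ (Finset.univ.filter fun c => f c = f i).erase i, a c) := by
  funext c'
  by_cases h : c' = f i
  · subst h
    rw [Function.update_self, ← Finset.mul_prod_erase _ _ (a := i) (by simp), Function.update_self]
    congr 1
    refine Finset.prod_congr rfl fun c hc => ?_
    rw [Function.update_of_ne (Finset.ne_of_mem_erase hc)]
  · rw [Function.update_of_ne h]
    refine Finset.prod_congr rfl fun c hc => ?_
    rw [Function.update_of_ne]
    rintro rfl
    exact h (Finset.mem_filter.1 hc).2.symm

/-- The `k`-linear map `A^{⊗ι} → A^{⊗κ}` induced by `f : ι → κ`: the pure tensor `⨂ a_c` goes to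
the pure tensor whose factor at `c'` is the product of the `a_c` with `f c = c'`. If `f` identifies
exactly two indices and is onto, this is the multiplication of the two corresponding factors; if `f`
is a bijection, it is the relabelling of the factors. -/
def mergeMap (f : ι → κ) : (⨂[k] _ : ι, A) →ₗ[k] (⨂[k] _ : κ, A) :=
  PiTensorProduct.lift
    { toFun := fun a => PiTensorProduct.tprod k fun c' => ∏ c with f c = c', a c
      map_update_add' := by
        intro _ a i x y
        simp only [fiberProd_update, add_mul, MultilinearMap.map_update_add]
      map_update_smul' := by
        intro _ a i r x
        simp only [fiberProd_update, smul_mul_assoc, MultilinearMap.map_update_smul] }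

theorem mergeMap_tprod (f : ι → κ) (a : ι → A) :
    mergeMap k A f (PiTensorProduct.tprod k a) =
      PiTensorProduct.tprod k fun c' => ∏ c with f c = c', a c :=
  PiTensorProduct.lift.tprod _

theorem mergeMap_comp [Fintype κ] [DecidableEq μ] (g : κ → μ) (f : ι → κ) (x : ⨂[k] _ : ι, A) :
    mergeMap k A g (mergeMap k A f x) = mergeMap k A (g ∘ f) x := by
  induction x using PiTensorProduct.induction_on with
  | smul_tprod r a =>
    simp only [map_smul, mergeMap_tprod]
    congr 2
    funext c'
    rw [← Finset.prod_fiberwise_of_maps_to (s := Finset.univ.filter fun c => (g ∘ f) c = c')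
      (t := Finset.univ.filter fun c => g c = c') (g := f) (by simp)]
    refine Finset.prod_congr rfl fun d hd => Finset.prod_congr ?_ fun _ _ => rfl
    ext c
    simp only [Finset.mem_filter, Finset.mem_univ, true_and, Function.comp_apply] at hd ⊢
    constructor
    · rintro rfl
      exact ⟨hd, rfl⟩
    · exact fun h => h.2
  | add x y hx hy => simp only [map_add, hx, hy]

/-- The part of degree `j` of `A^{⊗ι}`, where `𝒜 d ⊆ A` is the part of degree `d` of `A`: degrees of
the factors of a pure tensor add up. -/
def tensorDegree {k A : Type} [CommRing k] [CommRing A] [Algebra k A] (𝒜 : ℕ → Submodule k A)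
    (ι : Type) [Fintype ι] (j : ℕ) : Submodule k (⨂[k] _ : ι, A) :=
  Submodule.span k {z | ∃ (a : ι → A) (δ : ι → ℕ), (∀ c, a c ∈ 𝒜 (δ c)) ∧ ∑ c, δ c = j ∧
    z = PiTensorProduct.tprod k a}

end Merge

/-! ### States of a graph and the cochain complex -/

section Complex

variable {V : Type} {G : SimpleGraph V}

/-- `[G : s]`: the spanning subgraph of `G` with all the vertices of `G` and the edges in `s`. -/
def stateGraph (s : Finset G.edgeSet) : SimpleGraph V :=
  SimpleGraph.fromEdgeSet (Subtype.val '' (s : Set G.edgeSet))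

theorem stateGraph_mono {s t : Finset G.edgeSet} (h : s ⊆ t) : stateGraph s ≤ stateGraph t :=
  SimpleGraph.fromEdgeSet_mono (Set.image_mono (Finset.coe_subset.2 h))

/-- The connected components of `[G : s]`. -/
def Component (s : Finset G.edgeSet) : Type := (stateGraph s).ConnectedComponent

instance [Finite V] (s : Finset G.edgeSet) : Fintype (Component s) :=
  haveI : Finite (Component s) := inferInstanceAs (Finite (Quot (stateGraph s).Reachable))
  Fintype.ofFinite _

instance (s : Finset G.edgeSet) : DecidableEq (Component s) := Classical.decEq _

/-- If `s ⊆ t`, each component of `[G : s]` lies in a component of `[G : t]`. -/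
def componentMap {s t : Finset G.edgeSet} (h : s ⊆ t) : Component s → Component t :=
  SimpleGraph.ConnectedComponent.map (SimpleGraph.Hom.ofLE (stateGraph_mono h))

theorem componentMap_comp {s t u : Finset G.edgeSet} (h : s ⊆ t) (h' : t ⊆ u) :
    componentMap h' ∘ componentMap h = componentMap (h.trans h') := by
  funext c
  exact SimpleGraph.ConnectedComponent.map_comp c _ _

variable (k A : Type) [CommRing k] [CommRing A] [Algebra k A] (G)

/-- The states of `G` with `i` edges: the sets `s ⊆ E(G)` with `|s| = i`. -/
abbrev State (i : ℕ) : Type := {s : Finset G.edgeSet // s.card = i}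

/-- The cochain module `C^i_A(G) = ⨁_{|s| = i} A^{⊗ k(s)}`, with one tensor factor for each
component of `[G : s]`. (A finite graph has finitely many states, so the direct sum is the
product.) -/
abbrev Cochain (i : ℕ) : Type := (s : State G i) → ⨂[k] _ : Component s.1, A

open Classical in
/-- The state `t \ {e}`, for an edge `e` of the state `t`. -/
def State.remove {G : SimpleGraph V} {i : ℕ} (t : State G (i + 1)) (e : {e // e ∈ t.1}) :
    State G i :=
  ⟨t.1.erase e.1, by rw [Finset.card_erase_of_mem e.2, t.2, Nat.add_sub_cancel]⟩

theorem State.remove_subset {G : SimpleGraph V} {i : ℕ} (t : State G (i + 1))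
    (e : {e // e ∈ t.1}) : (t.remove e).1 ⊆ t.1 := by
  classical
  exact Finset.erase_subset _ _

variable {G}

/-- `t(s, e)`: the number of edges of `s` which precede `e`, where the edges of `G` are ordered by
means of the numbering `ν`. -/
def precCount (ν : G.edgeSet ↪ ℕ) (s : Finset G.edgeSet) (e : G.edgeSet) : ℕ :=
  (s.filter fun e' => ν e' < ν e).card

variable (ν : G.edgeSet ↪ ℕ)

open Classical in
theorem precCount_erase_self (s : Finset G.edgeSet) (e : G.edgeSet) :
    precCount ν (s.erase e) e = precCount ν s e := by
  unfold precCount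
  congr 1
  ext f
  simp only [Finset.mem_filter, Finset.mem_erase]
  exact ⟨fun h => ⟨h.1.2, h.2⟩, fun h => ⟨⟨by rintro rfl; exact lt_irrefl _ h.2, h.1⟩, h.2⟩⟩

open Classical in
theorem precCount_erase (s : Finset G.edgeSet) {e e' : G.edgeSet} (he : e ∈ s) :
    precCount ν (s.erase e) e' + (if ν e < ν e' then 1 else 0) = precCount ν s e' := by
  unfold precCount
  rw [Finset.filter_erase]
  split_ifs with h
  · exact Finset.card_erase_add_one (Finset.mem_filter.2 ⟨he, h⟩)
  · have hn : e ∉ s.filter fun f => ν f < ν e' := fun hm => h (Finset.mem_filter.1 hm).2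
    rw [Finset.erase_eq_of_notMem hn, add_zero]

open Classical in
theorem sign_swap (s : Finset G.edgeSet) {e e' : G.edgeSet} (he : e ∈ s) (he' : e' ∈ s)
    (hne : e ≠ e') :
    (-1 : k) ^ precCount ν (s.erase e) e * (-1 : k) ^ precCount ν ((s.erase e).erase e') e' +
      (-1 : k) ^ precCount ν (s.erase e') e' * (-1 : k) ^ precCount ν ((s.erase e').erase e) e =
      0 := by
  simp only [precCount_erase_self]
  have h1 := precCount_erase ν s (e' := e') he
  have h2 := precCount_erase ν s (e' := e) he'
  rcases lt_or_gt_of_ne (fun h => hne (ν.injective h)) with h | h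
  · rw [if_pos h] at h1
    rw [if_neg h.not_gt] at h2
    rw [← h1, ← h2]
    ring
  · rw [if_pos h] at h2
    rw [if_neg h.not_gt] at h1
    rw [← h1, ← h2]
    ring

variable [Finite V]

/-- The differential `d^i = ∑_{e ∉ s} (-1)^{t(s, e)} d_e : C^i_A(G) → C^{i+1}_A(G)`. The coordinate
of `d x` at a state `t` collects the edges `e ∈ t`, with `s = t \ {e}`. The map `d_e` from the
summand of `s` to that of `s ∪ {e}` multiplies the labels of the two components joined by `e`, and is
the identity if both ends of `e` lie in the same component of `[G : s]`. -/
def differential (i : ℕ) : Cochain G k A i →ₗ[k] Cochain G k A (i + 1) :=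
  LinearMap.pi fun t => ∑ e : {e // e ∈ t.1},
    (-1 : k) ^ precCount ν (t.remove e).1 e.1 •
      (mergeMap k A (componentMap (t.remove_subset e)) ∘ₗ LinearMap.proj (t.remove e))

variable {k A}

theorem differential_apply (i : ℕ) (x : Cochain G k A i) (t : State G (i + 1)) :
    differential k A ν i x t = ∑ e : {e // e ∈ t.1}, (-1 : k) ^ precCount ν (t.remove e).1 e.1 •
      mergeMap k A (componentMap (t.remove_subset e)) (x (t.remove e)) := by
  simp [differential]

variable (G) in
/-- `C^{i,j}_A(G)`: the cochains of degree `j`, for an algebra `A` graded by the `𝒜 d`. -/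
def gradedCochain (𝒜 : ℕ → Submodule k A) (i j : ℕ) : Submodule k (Cochain G k A i) :=
  Submodule.pi Set.univ fun s => tensorDegree 𝒜 (Component s.1) j

/-- The cocycles of bidegree `(i, j)`: the kernel of `d^i` on `C^{i,j}_A(G)`. -/
def cocycles (𝒜 : ℕ → Submodule k A) (i j : ℕ) : Submodule k (Cochain G k A i) :=
  gradedCochain G 𝒜 i j ⊓ LinearMap.ker (differential k A ν i)

/-- The coboundaries of bidegree `(i, j)`: the image of `C^{i-1,j}_A(G)` under `d^{i-1}`, which is
zero for `i = 0`. -/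
def coboundaries (𝒜 : ℕ → Submodule k A) : (i j : ℕ) → Submodule k (Cochain G k A i)
  | 0, _ => ⊥
  | i + 1, j => (gradedCochain G 𝒜 i j).map (differential k A ν i)

/-- `H^{i,j}_A(G)`: the chromatic graph cohomology of `G` over the graded algebra `A`, in bidegree
`(i, j)`. -/
abbrev Cohomology (𝒜 : ℕ → Submodule k A) (i j : ℕ) : Type :=
  cocycles ν 𝒜 i j ⧸ (coboundaries ν 𝒜 i j).submoduleOf (cocycles ν 𝒜 i j)

/-! ### The coboundaries are cocycles -/

theorem differential_comp (i : ℕ) (x : Cochain G k A i) :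
    differential k A ν (i + 1) (differential k A ν i x) = 0 := by
  classical
  funext t
  have key : ∀ (s s' : State G i) (hs : s.1 ⊆ t.1) (hs' : s'.1 ⊆ t.1), s = s' →
      mergeMap k A (componentMap hs) (x s) = mergeMap k A (componentMap hs') (x s') := by
    rintro s _ hs hs' rfl
    rfl
  simp only [differential_apply, map_sum, map_smul, Finset.smul_sum, mergeMap_comp,
    componentMap_comp, smul_smul, Pi.zero_apply]
  rw [Finset.sum_sigma']
  refine Finset.sum_involution
    (fun p _ => ⟨⟨p.2.1, t.remove_subset p.1 p.2.2⟩,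
      ⟨p.1.1, Finset.mem_erase.2 ⟨(Finset.mem_erase.1 p.2.2).1.symm, p.1.2⟩⟩⟩) ?_ ?_ ?_ ?_
  · rintro ⟨⟨e, he⟩, ⟨e', he'⟩⟩ -
    have hm := Finset.mem_erase.1 he'
    have h := sign_swap k ν t.1 he hm.2 (fun h => hm.1 h.symm)
    dsimp only
    have hs : (t.remove ⟨e', hm.2⟩).remove ⟨e, Finset.mem_erase.2 ⟨hm.1.symm, he⟩⟩ =
        (t.remove ⟨e, he⟩).remove ⟨e', he'⟩ := Subtype.ext Finset.erase_right_comm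
    rw [key _ _ (((t.remove ⟨e', hm.2⟩).remove_subset _).trans (t.remove_subset ⟨e', hm.2⟩))
      (((t.remove ⟨e, he⟩).remove_subset ⟨e', he'⟩).trans (t.remove_subset ⟨e, he⟩)) hs,
      ← add_smul]
    convert zero_smul k _ using 2
    exact h
  · rintro ⟨⟨e, he⟩, ⟨e', he'⟩⟩ - - h
    exact (Finset.mem_erase.1 he').1 (congrArg (fun p => p.1.1) h)
  · intro p _
    exact Finset.mem_univ _
  · intro p _
    rfl

/-- The multiplication of the factors of a tensor power preserves the degree. -/
theorem mergeMap_mem_tensorDegree {ι κ : Type} [Fintype ι] [Fintype κ] [DecidableEq κ]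
    (𝒜 : ℕ → Submodule k A) [SetLike.GradedMonoid 𝒜] (f : ι → κ) (j : ℕ) {z : ⨂[k] _ : ι, A}
    (hz : z ∈ tensorDegree 𝒜 ι j) : mergeMap k A f z ∈ tensorDegree 𝒜 κ j := by
  suffices h : tensorDegree 𝒜 ι j ≤ (tensorDegree 𝒜 κ j).comap (mergeMap k A f) from h hz
  refine Submodule.span_le.2 ?_
  rintro _ ⟨a, δ, ha, hδ, rfl⟩
  refine Submodule.subset_span ⟨_, fun c' => ∑ c with f c = c', δ c, fun c' => ?_, ?_,
    mergeMap_tprod k A f a⟩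
  · exact SetLike.prod_mem_graded _ _ _ fun c _ => ha c
  · rw [← hδ]
    exact Finset.sum_fiberwise _ _ _

theorem coboundaries_le_cocycles (𝒜 : ℕ → Submodule k A) [SetLike.GradedMonoid 𝒜] (i j : ℕ) :
    coboundaries ν 𝒜 i j ≤ cocycles ν 𝒜 i j := by
  cases i with
  | zero => exact bot_le
  | succ i =>
    rintro _ ⟨x, hx, rfl⟩
    refine ⟨fun t _ => ?_, differential_comp ν i x⟩
    rw [differential_apply]
    exact Submodule.sum_mem _ fun e _ => Submodule.smul_mem _ _
      (mergeMap_mem_tensorDegree 𝒜 _ j (hx _ trivial))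

end Complex

/-! ### Truncated polynomials -/

/-- `A_m = ℤ[x]/(x^m)`. -/
abbrev TruncPoly (m : ℕ) : Type := AdjoinRoot (Polynomial.X ^ m : Polynomial ℤ)

/-- The grading of `A_m` with `x` in degree `1`: the part of degree `d` is spanned by `x^d` (and is
zero for `d ≥ m`, where `x^d = 0`). -/
def truncPolyDegree (m d : ℕ) : Submodule ℤ (TruncPoly m) :=
  Submodule.span ℤ {AdjoinRoot.root (Polynomial.X ^ m : Polynomial ℤ) ^ d}

instance (m : ℕ) : SetLike.GradedMonoid (truncPolyDegree m) where
  one_mem := Submodule.mem_span_singleton.2 ⟨1, by simp⟩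
  mul_mem := by
    intro p q a b ha hb
    obtain ⟨r, rfl⟩ := Submodule.mem_span_singleton.1 ha
    obtain ⟨s, rfl⟩ := Submodule.mem_span_singleton.1 hb
    exact Submodule.mem_span_singleton.2 ⟨r * s, by rw [pow_add, smul_mul_smul_comm]⟩

end ChromaticCohomology

end

open scoped TensorProduct

noncomputable section

/-! In `K_n` a state with `i ≤ 2` edges has `n - i` components, so `C^i` has top degree `2(n - i)`.
Degree `2n - 3` is thus too large for `C^2`, one below the top in `C^1` and three below the top in
`C^0`. So the group is the cokernel of `d^0`. Its generators `φ(uv, w)` are the edges `uv` with `x`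
at the component of `w` and `x^2` at all others. The nonzero monomials of `C^0` either lack one
power of `x` at each of three vertices, or two at `u` and one at `v`; they give the relations `φ(pq,
r) + φ(pr, q) + φ(qr, p) = 0` and `∑_w φ(uw, v) = 0` (`exists_cohomology_generators`).

Torsion comes from `s_u = ∑_v φ(uv, u)`. Summing the triple relations through `u` and simplifying by
the pair relations gives `3 s_u = 0`. Fix the vertex `0` and put `β(ab) = φ(ab, a) - φ(ab, 0)` for
`a, b ≠ 0`; then `∑_b β(ab) = s_a`. All generators are expressed by the `β(ab)` and the inner values
`φ(ab, c)` with `a, b, c` distinct and nonzero. The only remaining constraints are `3 ∑_b β(ab) = 0`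
and one linear relation for each triple of inner values: conversely, any such data extend to a
solution of all relations (`EdgeData.edgeRelations`).

Let `ε` be the sum of `β` over the edges avoiding `0` and `1`. Double counting gives `2ε = ∑_{u ≥ 2}
s_u - s_1`, so, given `3 s_u = 0` for `u ≥ 2`, the condition `3 s_1 = 0` becomes `6ε = 0`.
Independent coordinates are therefore `ε` of order 6 (the source of `ℤ_2`), the `s_u` with `u ≥ 2`
of order 3, the values of `β` on all but one of the edges avoiding `0` and `1`, and two inner values
per triple. -/

namespace ChromaticCohomology

/-! ### Monomials in tensor powers of `ℤ[x]/(x^3)` -/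

section Monomials

variable {ι κ : Type}

/-- The pure tensor of powers of `x` with exponents `a`. -/
def mono (a : ι → ℕ) : ⨂[ℤ] _ : ι, TruncPoly 3 :=
  PiTensorProduct.tprod ℤ fun c => AdjoinRoot.root (Polynomial.X ^ 3 : Polynomial ℤ) ^ a c

theorem root_pow_eq_zero {d : ℕ} (hd : 3 ≤ d) :
    AdjoinRoot.root (Polynomial.X ^ 3 : Polynomial ℤ) ^ d = 0 := by
  have h : AdjoinRoot.root (Polynomial.X ^ 3 : Polynomial ℤ) ^ 3 = 0 := by
    rw [← AdjoinRoot.mk_X, ← map_pow, AdjoinRoot.mk_self]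
  rw [← Nat.add_sub_of_le hd, pow_add, h, zero_mul]

theorem mono_eq_zero {a : ι → ℕ} {c : ι} (hc : 3 ≤ a c) : mono a = 0 :=
  (PiTensorProduct.tprod ℤ).map_coord_zero c (root_pow_eq_zero hc)

/-- The coefficient of `x ^ d`, for `d < 3`. -/
def truncCoeff (d : ℕ) : TruncPoly 3 →ₗ[ℤ] ℤ :=
  Polynomial.lcoeff ℤ d ∘ₗ AdjoinRoot.modByMonicHom (Polynomial.monic_X_pow 3)

theorem truncCoeff_root_pow {d : ℕ} (hd : d < 3) (k : ℕ) :
    truncCoeff d (AdjoinRoot.root (Polynomial.X ^ 3 : Polynomial ℤ) ^ k) =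
      if k = d then 1 else 0 := by
  by_cases hk : 3 ≤ k
  · rw [root_pow_eq_zero hk, map_zero, if_neg (by omega)]
  · rw [← AdjoinRoot.mk_X, ← map_pow, truncCoeff, LinearMap.comp_apply,
      AdjoinRoot.modByMonicHom_mk, (Polynomial.modByMonic_eq_self_iff
        (Polynomial.monic_X_pow 3)).2, Polynomial.lcoeff_apply, Polynomial.coeff_X_pow]
    · simp only [eq_comm]
    · rw [Polynomial.degree_X_pow, Polynomial.degree_X_pow]
      exact_mod_cast not_le.1 hk

/-- The exponents of the monomial of degree one less than the maximum, which has `x` at `c`. -/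
def nearTop [DecidableEq ι] (c : ι) : ι → ℕ := fun c' => if c' = c then 1 else 2

theorem nearTop_injective [DecidableEq ι] : Function.Injective (nearTop : ι → ι → ℕ) := by
  intro c c' h
  have := congrFun h c
  by_contra hne
  simp [nearTop, hne] at this

theorem nearTop_lt [DecidableEq ι] (c c' : ι) : nearTop c c' < 3 := by
  unfold nearTop
  split_ifs <;> omega

variable [Fintype ι]

/-- The coefficient of the monomial with exponents `b`, all of them less than `3`. -/
def monoCoeff (b : ι → ℕ) : (⨂[ℤ] _ : ι, TruncPoly 3) →ₗ[ℤ] ℤ :=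
  PiTensorProduct.lift
    ((MultilinearMap.mkPiAlgebra ℤ ι ℤ).compLinearMap fun c => truncCoeff (b c))

theorem monoCoeff_mono {b : ι → ℕ} (hb : ∀ c, b c < 3) (a : ι → ℕ) [Decidable (a = b)] :
    monoCoeff b (mono a) = if a = b then 1 else 0 := by
  rw [monoCoeff, mono, PiTensorProduct.lift.tprod, MultilinearMap.compLinearMap_apply,
    MultilinearMap.mkPiAlgebra_apply]
  simp only [truncCoeff_root_pow (hb _)]
  split_ifs with h
  · simp [h]
  · obtain ⟨c, hc⟩ := Function.ne_iff.1 h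
    exact Finset.prod_eq_zero (Finset.mem_univ c) (if_neg hc)

theorem mergeMap_mono [DecidableEq κ] (f : ι → κ) (a : ι → ℕ) :
    mergeMap ℤ (TruncPoly 3) f (mono a) = mono fun c' => ∑ c with f c = c', a c := by
  simp only [mono, mergeMap_tprod, Finset.prod_pow_eq_pow_sum]

theorem tensorDegree_eq_span (j : ℕ) :
    tensorDegree (truncPolyDegree 3) ι j =
      Submodule.span ℤ {z | ∃ a : ι → ℕ, ∑ c, a c = j ∧ z = mono a} := by
  apply le_antisymm
  · refine Submodule.span_le.2 ?_
    rintro _ ⟨a, δ, ha, hδ, rfl⟩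
    choose r hr using fun c => Submodule.mem_span_singleton.1 (ha c)
    obtain rfl : (fun c => r c • AdjoinRoot.root (Polynomial.X ^ 3 : Polynomial ℤ) ^ δ c) = a :=
      funext hr
    rw [MultilinearMap.map_smul_univ]
    exact Submodule.smul_mem _ _ (Submodule.subset_span ⟨δ, hδ, rfl⟩)
  · refine Submodule.span_le.2 ?_
    rintro _ ⟨a, ha, rfl⟩
    exact Submodule.subset_span ⟨_, a, fun c => Submodule.mem_span_singleton_self _, ha, rfl⟩

theorem sum_nearTop [DecidableEq ι] (c : ι) : ∑ c', nearTop c c' + 1 = 2 * Fintype.card ι := by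
  have h (c') : nearTop c c' + (if c' = c then 1 else 0) = 2 := by
    unfold nearTop
    split_ifs <;> rfl
  have := Finset.sum_congr (s₁ := Finset.univ) rfl fun c' _ => h c'
  rw [Finset.sum_add_distrib, Finset.sum_ite_eq' Finset.univ c] at this
  simpa [mul_comm] using this

/-- The deficits `2 - a c` are natural numbers with sum `1`, so exactly one of them is nonzero. -/
theorem eq_nearTop [DecidableEq ι] {a : ι → ℕ} (ha : ∀ c, a c < 3)
    (hs : ∑ c, a c + 1 = 2 * Fintype.card ι) : ∃ c, a = nearTop c := by
  have h2 : ∑ c, (2 - a c) = 1 := by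
    have : ∑ c, (2 - a c) + ∑ c, a c = 2 * Fintype.card ι := by
      rw [← Finset.sum_add_distrib, Finset.sum_congr rfl fun c _ =>
        Nat.sub_add_cancel (Nat.lt_succ_iff.1 (ha c))]
      simp [mul_comm]
    omega
  obtain ⟨c, -, hc⟩ := Finset.exists_ne_zero_of_sum_ne_zero (h2.trans_ne one_ne_zero)
  rw [← Finset.add_sum_erase _ _ (Finset.mem_univ c)] at h2
  have h0 : ∑ c' ∈ Finset.univ.erase c, (2 - a c') = 0 := by omega
  refine ⟨c, funext fun c' => ?_⟩
  unfold nearTop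
  split_ifs with h
  · subst h
    omega
  · have := Finset.sum_eq_zero_iff.1 h0 c' (by simp [h])
    have := ha c'
    omega

theorem tensorDegree_nearTop [DecidableEq ι] {j : ℕ} (hj : j + 1 = 2 * Fintype.card ι) :
    tensorDegree (truncPolyDegree 3) ι j =
      Submodule.span ℤ (Set.range fun c : ι => mono (nearTop c)) := by
  rw [tensorDegree_eq_span]
  apply le_antisymm
  · refine Submodule.span_le.2 ?_
    rintro _ ⟨a, ha, rfl⟩
    by_cases h : ∀ c, a c < 3
    · obtain ⟨c, rfl⟩ := eq_nearTop h (ha ▸ hj)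
      exact Submodule.subset_span ⟨c, rfl⟩
    · push Not at h
      obtain ⟨c, hc⟩ := h
      rw [mono_eq_zero hc]
      exact zero_mem _
  · refine Submodule.span_le.2 ?_
    rintro _ ⟨c, rfl⟩
    exact Submodule.subset_span ⟨_, by have := sum_nearTop c; omega, rfl⟩

end Monomials

/-! ### Components of states with at most one edge -/

section States

variable {V : Type} {G : SimpleGraph V}

/-- The component of a vertex. -/
def comp (s : Finset G.edgeSet) (v : V) : Component s := (stateGraph s).connectedComponentMk v

theorem comp_surjective (s : Finset G.edgeSet) : Function.Surjective (comp s) :=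
  Quot.mk_surjective

theorem componentMap_comp_apply {s t : Finset G.edgeSet} (h : s ⊆ t) (v : V) :
    componentMap h (comp s v) = comp t v := rfl

/-- Separates components: an invariant of adjacent vertices is constant on components, so two
vertices with different values lie in different ones. -/
theorem comp_eq_of_map {W : Type} {s : Finset G.edgeSet} (f : V → W)
    (hf : ∀ v w, (stateGraph s).Adj v w → f v = f w) {x y : V} (h : comp s x = comp s y) :
    f x = f y := by
  obtain ⟨p⟩ := SimpleGraph.ConnectedComponent.exact h
  induction p with
  | nil => rfl
  | cons hadj _ ih => exact (hf _ _ hadj).trans (ih (Quot.sound ⟨‹_›⟩))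

theorem comp_empty_injective : Function.Injective (comp (∅ : Finset G.edgeSet)) := by
  intro x y h
  exact comp_eq_of_map id (fun v w hvw => by simp [stateGraph] at hvw) h

/-- The state of the complete graph with the single edge `uv`. -/
def edgeState {u v : V} (h : u ≠ v) : State (⊤ : SimpleGraph V) 1 :=
  ⟨{⟨s(u, v), h⟩}, rfl⟩

theorem edgeState_symm {u v : V} (h : u ≠ v) : edgeState h = edgeState h.symm := by
  unfold edgeState
  simp only [Sym2.eq_swap]

theorem edgeState_inj {u v x y : V} {h : u ≠ v} {h' : x ≠ y} :
    edgeState h = edgeState h' ↔ u = x ∧ v = y ∨ u = y ∧ v = x := by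
  simp [edgeState, Subtype.ext_iff]

theorem exists_edgeState (t : State (⊤ : SimpleGraph V) 1) :
    ∃ (u v : V) (h : u ≠ v), t = edgeState h := by
  obtain ⟨t, ht⟩ := t
  obtain ⟨⟨e, he⟩, rfl⟩ := Finset.card_eq_one.1 ht
  induction e using Sym2.ind with
  | _ u v => exact ⟨u, v, he, rfl⟩

theorem comp_edgeState_iff {u v : V} (h : u ≠ v) {x y : V} :
    comp (edgeState h).1 x = comp (edgeState h).1 y ↔
      x = y ∨ (x = u ∨ x = v) ∧ (y = u ∨ y = v) := by
  classical
  have hadj : ∀ a b, (stateGraph (edgeState h).1).Adj a b ↔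
      (a = u ∧ b = v ∨ a = v ∧ b = u) := by
    intro a b
    simp only [stateGraph, edgeState, SimpleGraph.fromEdgeSet_adj, Finset.coe_singleton,
      Set.image_singleton, Set.mem_singleton_iff, Sym2.eq_iff]
    grind
  have huv : comp (edgeState h).1 u = comp (edgeState h).1 v :=
    SimpleGraph.ConnectedComponent.sound ((hadj u v).2 (Or.inl ⟨rfl, rfl⟩)).reachable
  constructor
  · intro hc
    -- The invariant contracts the edge, sending `v` to `u` and fixing every other vertex.
    have := comp_eq_of_map (fun a => if a = v then u else a)
      (fun a b hab => by rcases (hadj a b).1 hab with ⟨rfl, rfl⟩ | ⟨rfl, rfl⟩ <;> simp) hc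
    grind
  · rintro (rfl | ⟨rfl | rfl, rfl | rfl⟩) <;> simp [huv]

end States

/-! ### Bases of the cochains of degree `2n - 3` -/

section Cochains

variable {n : ℕ}

/-- The complete graph on `n` vertices. -/
abbrev KGraph (n : ℕ) : SimpleGraph (Fin n) := ⊤

instance : Unique (State (KGraph n) 0) where
  default := ⟨∅, rfl⟩
  uniq s := Subtype.ext (Finset.card_eq_zero.1 s.2)

/-- The monomial on the components of a state in which each vertex `v` contributes an exponent
`h v` to its component. -/
def vertexMono (s : Finset (KGraph n).edgeSet) (h : Fin n → ℕ) : ⨂[ℤ] _ : Component s, TruncPoly 3 :=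
  mono fun c => ∑ v with comp s v = c, h v

/-- Exponents add under multiplication, so indexing a monomial by vertex exponents makes it
compatible with every merging of components. Differentials can then be read off vertex by vertex. -/
theorem mergeMap_vertexMono {s t : Finset (KGraph n).edgeSet} (hst : s ⊆ t) (h : Fin n → ℕ) :
    mergeMap ℤ (TruncPoly 3) (componentMap hst) (vertexMono s h) = vertexMono t h := by
  rw [vertexMono, mergeMap_mono, vertexMono]
  congr 1
  funext c
  rw [← Finset.sum_fiberwise_of_maps_to (s := Finset.univ.filter fun v => comp t v = c)
    (t := Finset.univ.filter fun d => componentMap hst d = c) (g := comp s)]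
  · refine Finset.sum_congr rfl fun d hd => Finset.sum_congr ?_ fun _ _ => rfl
    ext v
    simp only [Finset.mem_filter, Finset.mem_univ, true_and] at hd ⊢
    constructor
    · rintro rfl
      exact ⟨hd, rfl⟩
    · exact fun h => h.2
  · intro v hv
    simpa [componentMap_comp_apply] using hv

/-- The cochain of degree zero given by a monomial. -/
def vertexCochain (h : Fin n → ℕ) : Cochain (KGraph n) ℤ (TruncPoly 3) 0 :=
  fun s => vertexMono s.1 h

/-- A one-edge state arises only from the empty state, where no edge precedes the new one, so the
sign is `+1` for every ordering. -/
theorem differential_vertexCochain (ν : (KGraph n).edgeSet ↪ ℕ) (h : Fin n → ℕ)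
    (t : State (KGraph n) 1) :
    differential ℤ (TruncPoly 3) ν 0 (vertexCochain h) t = vertexMono t.1 h := by
  have : Unique {e // e ∈ t.1} := by
    refine (Fintype.card_eq_one_iff_nonempty_unique.1 ?_).some
    rw [Fintype.card_coe, t.2]
  rw [differential_apply, Fintype.sum_unique]
  have h0 : (t.remove default).1 = ∅ := Finset.card_eq_zero.1 (t.remove default).2
  rw [vertexCochain, mergeMap_vertexMono, precCount, h0]
  simp

theorem gradedCochain_zero_le (j : ℕ) :
    gradedCochain (KGraph n) (truncPolyDegree 3) 0 j ≤
      Submodule.span ℤ {x | ∃ h : Fin n → ℕ, ∑ v, h v = j ∧ x = vertexCochain h} := by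
  intro x hx
  let s : State (KGraph n) 0 := default
  have hbij : Function.Bijective (comp s.1) := ⟨comp_empty_injective, comp_surjective _⟩
  have hxs : x = LinearMap.single ℤ (fun s : State (KGraph n) 0 =>
      ⨂[ℤ] _ : Component s.1, TruncPoly 3) s (x s) := by
    funext s'
    obtain rfl : s' = s := Subsingleton.elim _ _
    simp
  have : x s ∈ tensorDegree (truncPolyDegree 3) (Component s.1) j := hx s trivial
  rw [tensorDegree_eq_span] at this
  rw [hxs]
  refine (Submodule.map_le_iff_le_comap.2 ?_) (Submodule.mem_map_of_mem this)
  refine Submodule.span_le.2 ?_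
  rintro _ ⟨a, ha, rfl⟩
  refine Submodule.subset_span ⟨a ∘ comp s.1, ?_, ?_⟩
  · rw [← ha]
    exact hbij.sum_comp a
  · funext s'
    obtain rfl : s' = s := Subsingleton.elim _ _
    simp only [LinearMap.single_apply, Pi.single_eq_same, vertexCochain, vertexMono]
    congr 1
    funext c
    obtain ⟨v, rfl⟩ := comp_surjective _ c
    rw [Finset.sum_eq_single v]
    · rfl
    · intro w hw hne
      exact absurd (hbij.1 (Finset.mem_filter.1 hw).2) hne
    · simp

theorem vertexCochain_mem (h : Fin n → ℕ) :
    vertexCochain h ∈ gradedCochain (KGraph n) (truncPolyDegree 3) 0 (∑ v, h v) := by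
  intro s _
  change _ ∈ tensorDegree (truncPolyDegree 3) (Component s.1) _
  rw [tensorDegree_eq_span]
  exact Submodule.subset_span ⟨_, Finset.sum_fiberwise _ _ _, rfl⟩

/-- The cochain of the edge `uv` with `x` at the component of `w`, and `x ^ 2` at the others. -/
def edgeCochain (u v w : Fin n) : Cochain (KGraph n) ℤ (TruncPoly 3) 1 :=
  if h : u ≠ v then Pi.single (edgeState h) (mono (nearTop (comp (edgeState h).1 w))) else 0

theorem edgeCochain_self (u w : Fin n) : edgeCochain u u w = 0 := dif_neg (by simp)

theorem edgeCochain_symm (u v w : Fin n) : edgeCochain u v w = edgeCochain v u w := by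
  unfold edgeCochain
  by_cases h : u = v
  · subst h
    rfl
  · rw [dif_pos h, dif_pos (Ne.symm h)]
    have := edgeState_symm h
    generalize edgeState h = s at *
    subst this
    rfl

theorem edgeCochain_end {u v : Fin n} : edgeCochain u v u = edgeCochain u v v := by
  unfold edgeCochain
  split_ifs with h
  · rw [(comp_edgeState_iff h).2 (Or.inr ⟨Or.inl rfl, Or.inr rfl⟩)]
  · rfl

theorem edgeCochain_apply_of_ne {u v x y : Fin n} (h : x ≠ y) (hne : ¬(u = x ∧ v = y ∨ u = y ∧ v = x))
    (w : Fin n) : edgeCochain u v w (edgeState h) = 0 := by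
  unfold edgeCochain
  split_ifs with h'
  · exact Pi.single_eq_of_ne (fun h => hne (edgeState_inj.1 h.symm)) _
  · rfl

theorem edgeCochain_apply_self {u v : Fin n} (h : u ≠ v) (w : Fin n) :
    edgeCochain u v w (edgeState h) = mono (nearTop (comp (edgeState h).1 w)) := by
  unfold edgeCochain
  rw [dif_pos h, Pi.single_eq_same]

theorem card_component_edgeState {u v : Fin n} (h : u ≠ v) :
    Fintype.card (Component (edgeState h).1) + 1 = n := by
  classical
  -- The vertices other than `v` represent each component exactly once.
  have : Fintype.card {w : Fin n // w ≠ v} = Fintype.card (Component (edgeState h).1) := by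
    refine Fintype.card_of_bijective (f := fun w => comp (edgeState h).1 w.1) ⟨?_, ?_⟩
    · intro x y hxy
      have := (comp_edgeState_iff h).1 hxy
      have := x.2
      have := y.2
      apply Subtype.ext
      grind
    · intro c
      obtain ⟨w, rfl⟩ := comp_surjective _ c
      by_cases hw : w = v
      · exact ⟨⟨u, h⟩, (comp_edgeState_iff h).2 (by simp [hw])⟩
      · exact ⟨⟨w, hw⟩, rfl⟩
  rw [← this, Fintype.card_subtype_compl, Fintype.card_fin, Fintype.card_subtype_eq]
  have := u.pos
  omega

/-- Each one-edge state has `n - 1` components, so `2n - 3` is one below the maximal degree `2(n -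
1)`. -/
theorem gradedCochain_one (hn : 2 ≤ n) :
    gradedCochain (KGraph n) (truncPolyDegree 3) 1 (2 * n - 3) =
      Submodule.span ℤ {x | ∃ u v w : Fin n, x = edgeCochain u v w} := by
  classical
  apply le_antisymm
  · intro x hx
    rw [← Finset.univ_sum_single x]
    refine Submodule.sum_mem _ fun s _ => ?_
    obtain ⟨u, v, h, rfl⟩ := exists_edgeState s
    have : x (edgeState h) ∈ tensorDegree (truncPolyDegree 3) (Component (edgeState h).1) _ :=
      hx (edgeState h) trivial
    have hc := card_component_edgeState h
    rw [tensorDegree_nearTop (by omega)] at this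
    refine (Submodule.map_le_iff_le_comap (f := LinearMap.single ℤ _ (edgeState h)).2 ?_)
      (Submodule.mem_map_of_mem this)
    refine Submodule.span_le.2 ?_
    rintro _ ⟨c, rfl⟩
    obtain ⟨w, rfl⟩ := comp_surjective _ c
    exact Submodule.subset_span ⟨u, v, w, by rw [edgeCochain, dif_pos h]; rfl⟩
  · refine Submodule.span_le.2 ?_
    rintro _ ⟨u, v, w, rfl⟩ s -
    obtain ⟨x, y, h, rfl⟩ := exists_edgeState s
    have hc := card_component_edgeState h
    change _ ∈ tensorDegree (truncPolyDegree 3) (Component (edgeState h).1) _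
    by_cases hne : u = x ∧ v = y ∨ u = y ∧ v = x
    · have : edgeCochain u v w = edgeCochain x y w := by
        rcases hne with ⟨rfl, rfl⟩ | ⟨rfl, rfl⟩
        · rfl
        · exact edgeCochain_symm _ _ _
      rw [this, edgeCochain_apply_self, tensorDegree_nearTop (by omega)]
      exact Submodule.subset_span ⟨_, rfl⟩
    · rw [edgeCochain_apply_of_ne h hne]
      exact zero_mem _

/-- A function of the edge and the vertex which respects the identities between the `edgeCochain`s
extends to a linear map. -/
theorem exists_linearMap_edgeCochain {A : Type} [AddCommGroup A] [Module ℤ A]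
    (φ : Fin n → Fin n → Fin n → A) (hself : ∀ u w, φ u u w = 0)
    (hsymm : ∀ u v w, φ u v w = φ v u w) (hend : ∀ u v, φ u v u = φ u v v) :
    ∃ Φ : Cochain (KGraph n) ℤ (TruncPoly 3) 1 →ₗ[ℤ] A, ∀ u v w, Φ (edgeCochain u v w) = φ u v w := by
  classical
  obtain rfl : ‹Module ℤ A› = AddCommGroup.toIntModule A := Subsingleton.elim _ _
  -- The three identities are exactly the ambiguities in naming a basis element by `(u, v, w)`, so
  -- `φ` descends to pairs of a state and a component. The equality of components is heterogeneous
  -- because their type depends on the state.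
  have key : ∀ (s : State (KGraph n) 1) (c : Component s.1), ∃ a : A,
      ∀ u v (h : u ≠ v) w, s = edgeState h → c ≍ comp (edgeState h).1 w → φ u v w = a := by
    intro s c
    obtain ⟨u, v, h, rfl⟩ := exists_edgeState s
    obtain ⟨w, rfl⟩ := comp_surjective _ c
    refine ⟨φ u v w, ?_⟩
    intro u' v' h' w' hs hc
    obtain hs' := edgeState_inj.1 hs
    have hc' : comp (edgeState h).1 w = comp (edgeState h).1 w' := by
      rcases hs' with ⟨rfl, rfl⟩ | ⟨rfl, rfl⟩
      · exact eq_of_heq hc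
      · generalize edgeState h' = s' at *
        subst hs
        exact eq_of_heq hc
    have hc' := (comp_edgeState_iff h).1 hc'
    rcases hs' with ⟨rfl, rfl⟩ | ⟨rfl, rfl⟩ <;> grind
  choose a ha using key
  refine ⟨∑ s : State (KGraph n) 1, ∑ c : Component s.1,
    (LinearMap.toSpanSingleton ℤ A (a s c)) ∘ₗ monoCoeff (nearTop c) ∘ₗ LinearMap.proj s, ?_⟩
  intro u v w
  by_cases h : u = v
  · subst h
    rw [edgeCochain_self, hself, map_zero]
  · rw [ha _ _ u v h w rfl HEq.rfl, LinearMap.sum_apply, Finset.sum_eq_single (edgeState h),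
      LinearMap.sum_apply, Finset.sum_eq_single (comp (edgeState h).1 w)]
    · simp [edgeCochain_apply_self, monoCoeff_mono (nearTop_lt _)]
    · intro c _ hc
      simp [edgeCochain_apply_self, monoCoeff_mono (nearTop_lt _), nearTop_injective.eq_iff, hc.symm]
    · simp
    · intro s _ hs
      refine (LinearMap.sum_apply _ _ _).trans (Finset.sum_eq_zero fun c _ => ?_)
      rw [edgeCochain, dif_pos h]
      simp [Pi.single_eq_of_ne hs]
    · simp

end Cochains

/-! ### The presentation of the cohomology group -/

section Relations

variable {n : ℕ}

theorem filter_comp_edgeState_ends {x y : Fin n} (h : x ≠ y) {z : Fin n} (hz : z = x ∨ z = y) :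
    (Finset.univ.filter fun v => comp (edgeState h).1 v = comp (edgeState h).1 z) = {x, y} := by
  ext v
  simp only [Finset.mem_filter, Finset.mem_univ, true_and, comp_edgeState_iff, Finset.mem_insert,
    Finset.mem_singleton]
  grind

theorem filter_comp_edgeState_other {x y : Fin n} (h : x ≠ y) {z : Fin n} (hz : ¬(z = x ∨ z = y)) :
    (Finset.univ.filter fun v => comp (edgeState h).1 v = comp (edgeState h).1 z) = {z} := by
  ext v
  simp only [Finset.mem_filter, Finset.mem_univ, true_and, comp_edgeState_iff,
    Finset.mem_singleton]
  grind

theorem vertexMono_eq_zero (s : Finset (KGraph n).edgeSet) {f : Fin n → ℕ} {v : Fin n}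
    (hv : 3 ≤ f v) : vertexMono s f = 0 :=
  mono_eq_zero (c := comp s v) <| hv.trans <|
    Finset.single_le_sum (f := f) (fun _ _ => Nat.zero_le _) (by simp)

theorem vertexMono_edgeState_eq_zero {x y : Fin n} (h : x ≠ y) {f : Fin n → ℕ}
    (hf : 3 ≤ f x + f y) : vertexMono (edgeState h).1 f = 0 := by
  refine mono_eq_zero (c := comp (edgeState h).1 x) ?_
  rwa [filter_comp_edgeState_ends h (Or.inl rfl), Finset.sum_pair h]

theorem vertexMono_edgeState {x y : Fin n} (h : x ≠ y) {f : Fin n → ℕ} {w : Fin n}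
    (hxy : f x + f y = if w = x ∨ w = y then 1 else 2)
    (hf : ∀ z, ¬(z = x ∨ z = y) → f z = if z = w then 1 else 2) :
    vertexMono (edgeState h).1 f = mono (nearTop (comp (edgeState h).1 w)) := by
  rw [vertexMono]
  congr 1
  funext c
  obtain ⟨z, rfl⟩ := comp_surjective _ c
  simp only [nearTop]
  by_cases hz : z = x ∨ z = y
  · rw [filter_comp_edgeState_ends h hz, Finset.sum_pair h, hxy]
    simp only [comp_edgeState_iff]
    congr 1
    grind
  · rw [filter_comp_edgeState_other h hz, Finset.sum_singleton, hf z hz]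
    simp only [comp_edgeState_iff]
    congr 1
    grind

variable (ν : (KGraph n).edgeSet ↪ ℕ)

/-- An edge inside `{p, q, r}` merges `x` with `x` and leaves `x` at the third vertex. Any other
edge has an end carrying `x^2`, and the product has exponent at least `3`. -/
theorem differential_triple {p q r : Fin n} (hpq : p ≠ q) (hpr : p ≠ r) (hqr : q ≠ r) :
    differential ℤ (TruncPoly 3) ν 0
        (vertexCochain fun z => if z = p ∨ z = q ∨ z = r then 1 else 2) =
      edgeCochain p q r + edgeCochain p r q + edgeCochain q r p := by
  funext t
  obtain ⟨x, y, h, rfl⟩ := exists_edgeState t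
  rw [differential_vertexCochain, Pi.add_apply, Pi.add_apply]
  have key : ∀ u v w, u ≠ v → u ≠ w → v ≠ w →
      (∀ z, (z = p ∨ z = q ∨ z = r) ↔ (z = u ∨ z = v ∨ z = w)) →
      (u = x ∧ v = y ∨ u = y ∧ v = x) →
      vertexMono (edgeState h).1 (fun z => if z = p ∨ z = q ∨ z = r then 1 else 2) =
        edgeCochain u v w (edgeState h) := by
    intro u v w huv huw hvw hz hxy
    have : edgeCochain u v w = edgeCochain x y w := by
      rcases hxy with ⟨rfl, rfl⟩ | ⟨rfl, rfl⟩
      · rfl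
      · exact edgeCochain_symm _ _ _
    rw [this, edgeCochain_apply_self]
    simp only [hz]
    apply vertexMono_edgeState <;> grind
  by_cases h1 : p = x ∧ q = y ∨ p = y ∧ q = x
  · rw [key p q r hpq hpr hqr (by grind) h1, edgeCochain_apply_of_ne (u := p) (v := r) h (by grind),
      edgeCochain_apply_of_ne (u := q) (v := r) h (by grind), add_zero, add_zero]
  rw [edgeCochain_apply_of_ne h h1, zero_add (edgeCochain p r q _)]
  by_cases h2 : p = x ∧ r = y ∨ p = y ∧ r = x
  · rw [key p r q hpr hpq hqr.symm (by grind) h2,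
      edgeCochain_apply_of_ne (u := q) (v := r) h (by grind), add_zero]
  rw [edgeCochain_apply_of_ne h h2, zero_add (edgeCochain q r p _)]
  by_cases h3 : q = x ∧ r = y ∨ q = y ∧ r = x
  · exact key q r p hqr hpq.symm hpr.symm (by grind) h3
  rw [edgeCochain_apply_of_ne h h3]
  exact vertexMono_edgeState_eq_zero h (by grind)

/-- The label `1` at `u` preserves the label of the other end of an edge at `u`; an edge avoiding
`u` yields exponent at least `3`. The term `w = u` vanishes by convention, and `w = v` puts `x` on
the edge itself. -/
theorem differential_pair {u v : Fin n} (huv : u ≠ v) :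
    differential ℤ (TruncPoly 3) ν 0
        (vertexCochain fun z => if z = u then 0 else if z = v then 1 else 2) =
      ∑ w, edgeCochain u w v := by
  funext t
  obtain ⟨x, y, h, rfl⟩ := exists_edgeState t
  rw [differential_vertexCochain, Finset.sum_apply]
  by_cases hu : u = x ∨ u = y
  · wlog hx : u = x generalizing x y
    · have h' := hu.resolve_left hx
      have := this y x h.symm (Or.inl h') h'
      rwa [← edgeState_symm h] at this
    subst hx
    rw [Finset.sum_eq_single y, edgeCochain_apply_self]
    · apply vertexMono_edgeState <;> grind
    · intro w _ hw
      exact edgeCochain_apply_of_ne h (by grind) _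
    · simp
  · rw [vertexMono_edgeState_eq_zero h (by grind), Finset.sum_eq_zero]
    intro w _
    exact edgeCochain_apply_of_ne h (by grind) _

theorem eq_add_single_of_sum_eq_succ {b : Fin n → ℕ} {k : ℕ} (h : ∑ v, b v = k + 1) :
    ∃ (p : Fin n) (b' : Fin n → ℕ), ∑ v, b' v = k ∧ ∀ v, b v = b' v + if v = p then 1 else 0 := by
  obtain ⟨p, -, hp⟩ := Finset.exists_ne_zero_of_sum_ne_zero (h.trans_ne k.succ_ne_zero)
  have hb : ∀ v, b v = (b v - if v = p then 1 else 0) + if v = p then 1 else 0 := by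
    intro v
    split_ifs with hv
    · subst hv
      omega
    · rfl
  refine ⟨p, fun v => b v - if v = p then 1 else 0, ?_, hb⟩
  rw [Finset.sum_congr rfl fun v _ => hb v, Finset.sum_add_distrib, Finset.sum_ite_eq'] at h
  simpa using h

/-- The deficits `2 - f v` add up to `3`. Remove three units, at `p`, `q`, `r`: they cannot all
coincide since a deficit is at most `2`, so they are distinct or exactly two agree. -/
theorem exists_of_sum_eq {f : Fin n → ℕ} (hf : ∀ v, f v < 3) (hs : ∑ v, f v + 3 = 2 * n) :
    (∃ p q r, p ≠ q ∧ p ≠ r ∧ q ≠ r ∧ f = fun z => if z = p ∨ z = q ∨ z = r then 1 else 2) ∨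
    ∃ u v, u ≠ v ∧ f = fun z => if z = u then 0 else if z = v then 1 else 2 := by
  have h3 : ∑ v, (2 - f v) = 3 := by
    have : ∑ v, (2 - f v) + ∑ v, f v = 2 * n := by
      rw [← Finset.sum_add_distrib, Finset.sum_congr rfl fun v _ =>
        Nat.sub_add_cancel (Nat.lt_succ_iff.1 (hf v))]
      simp [mul_comm]
    omega
  obtain ⟨p, b₁, h2, hb₁⟩ := eq_add_single_of_sum_eq_succ h3
  obtain ⟨q, b₂, h1, hb₂⟩ := eq_add_single_of_sum_eq_succ h2
  obtain ⟨r, b₃, h0, hb₃⟩ := eq_add_single_of_sum_eq_succ h1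
  have hf' : ∀ v, f v + (if v = r then 1 else 0) + (if v = q then 1 else 0) +
      (if v = p then 1 else 0) = 2 := by
    intro v
    have := Finset.sum_eq_zero_iff.1 h0 v (Finset.mem_univ v)
    have := hf v
    have := hb₁ v
    have := hb₂ v
    have := hb₃ v
    omega
  have hp := hf' p
  have hq := hf' q
  by_cases hpq : p = q
  · have hpr : p ≠ r := by grind
    refine Or.inr ⟨p, r, hpr, funext fun z => ?_⟩
    have := hf' z
    grind
  by_cases hpr : p = r
  · refine Or.inr ⟨p, q, hpq, funext fun z => ?_⟩
    have := hf' z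
    grind
  by_cases hqr : q = r
  · refine Or.inr ⟨q, p, Ne.symm hpq, funext fun z => ?_⟩
    have := hf' z
    grind
  refine Or.inl ⟨p, q, r, hpq, hpr, hqr, funext fun z => ?_⟩
  have := hf' z
  grind

/-- A second edge joins two components of the one-edge state. At most one of them carries `x`
instead of `x^2`, so their product has exponent at least `3`. -/
theorem mergeMap_edgeCochain {x y : Fin n} (h : x ≠ y) {t : Finset (KGraph n).edgeSet}
    (hsub : (edgeState h).1 ⊆ t) {e : (KGraph n).edgeSet} (he : e ∉ (edgeState h).1) (het : e ∈ t)
    (u v w : Fin n) :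
    mergeMap ℤ (TruncPoly 3) (componentMap hsub) (edgeCochain u v w (edgeState h)) = 0 := by
  obtain ⟨e, hee⟩ := e
  induction e using Sym2.ind with
  | _ a b =>
  have hab : a ≠ b := hee
  by_cases hne : u = x ∧ v = y ∨ u = y ∧ v = x
  swap
  · rw [edgeCochain_apply_of_ne h hne, map_zero]
  have : edgeCochain u v w = edgeCochain x y w := by
    rcases hne with ⟨rfl, rfl⟩ | ⟨rfl, rfl⟩
    · rfl
    · exact edgeCochain_symm _ _ _
  rw [this, edgeCochain_apply_self, mergeMap_mono, mono_eq_zero (c := comp t a)]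
  have hcomp : comp t a = comp t b := by
    refine SimpleGraph.ConnectedComponent.sound (SimpleGraph.Adj.reachable ?_)
    rw [stateGraph, SimpleGraph.fromEdgeSet_adj]
    exact ⟨⟨_, het, rfl⟩, hab⟩
  have hne : comp (edgeState h).1 a ≠ comp (edgeState h).1 b := by
    intro hc
    have := (comp_edgeState_iff h).1 hc
    apply he
    simp only [edgeState, Finset.mem_singleton]
    grind
  calc 3 ≤ ∑ c ∈ {comp (edgeState h).1 a, comp (edgeState h).1 b},
        nearTop (comp (edgeState h).1 w) c := by
        rw [Finset.sum_pair hne, nearTop, nearTop]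
        split_ifs with h1 h2
        · exact absurd (h1.trans h2.symm) hne
        all_goals omega
    _ ≤ _ := by
        refine Finset.sum_le_sum_of_subset fun c hc => ?_
        rcases Finset.mem_insert.1 hc with rfl | hc
        · simp [componentMap_comp_apply]
        · rw [Finset.mem_singleton.1 hc]
          simp [componentMap_comp_apply, hcomp]

theorem differential_edgeCochain (u v w : Fin n) :
    differential ℤ (TruncPoly 3) ν 1 (edgeCochain u v w) = 0 := by
  funext t
  rw [differential_apply]
  have key : ∀ (s : State (KGraph n) 1) (hsub : s.1 ⊆ t.1) (e : (KGraph n).edgeSet), e ∉ s.1 →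
      e ∈ t.1 → mergeMap ℤ (TruncPoly 3) (componentMap hsub) (edgeCochain u v w s) = 0 := by
    intro s hsub e he het
    obtain ⟨x, y, h, rfl⟩ := exists_edgeState s
    exact mergeMap_edgeCochain h hsub he het u v w
  refine Finset.sum_eq_zero fun e _ => ?_
  rw [key _ (t.remove_subset e) e.1 (by simp [State.remove]) e.2, smul_zero]

/-- The relations between the classes of the `edgeCochain`s. -/
structure EdgeRelations {n : ℕ} {A : Type} [AddCommGroup A] (φ : Fin n → Fin n → Fin n → A) :
    Prop where
  self : ∀ u w, φ u u w = 0
  symm : ∀ u v w, φ u v w = φ v u w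
  ends : ∀ u v, φ u v u = φ u v v
  triple : ∀ p q r, p ≠ q → p ≠ r → q ≠ r → φ p q r + φ p r q + φ q r p = 0
  pair : ∀ u v, u ≠ v → ∑ w, φ u w v = 0

/-- The cohomology in bidegree `(1, 2 n - 3)` is generated by elements subject to the
`EdgeRelations`, universally. -/
theorem exists_cohomology_generators (hn : 2 ≤ n) :
    ∃ γ : Fin n → Fin n → Fin n → Cohomology ν (truncPolyDegree 3) 1 (2 * n - 3),
      EdgeRelations γ ∧
      (∀ N : AddSubgroup (Cohomology ν (truncPolyDegree 3) 1 (2 * n - 3)),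
        (∀ u v w, γ u v w ∈ N) → N = ⊤) ∧
      ∀ (A : Type) [AddCommGroup A] (φ : Fin n → Fin n → Fin n → A), EdgeRelations φ →
        ∃ Φ : Cohomology ν (truncPolyDegree 3) 1 (2 * n - 3) →+ A, ∀ u v w, Φ (γ u v w) = φ u v w := by
  have hgr := gradedCochain_one hn
  set Z := cocycles ν (truncPolyDegree 3) 1 (2 * n - 3) with hZ
  set B := coboundaries ν (truncPolyDegree 3) 1 (2 * n - 3) with hB
  have hmem : ∀ u v w, edgeCochain u v w ∈ Z := fun u v w =>
    ⟨hgr ▸ Submodule.subset_span ⟨u, v, w, rfl⟩, differential_edgeCochain ν u v w⟩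
  let g (u v w : Fin n) : Z := ⟨edgeCochain u v w, hmem u v w⟩
  have hcob : ∀ f : Fin n → ℕ, ∑ v, f v + 3 = 2 * n →
      differential ℤ (TruncPoly 3) ν 0 (vertexCochain f) ∈ B := fun f hf =>
    Submodule.mem_map_of_mem ((by omega : ∑ v, f v = 2 * n - 3) ▸ vertexCochain_mem f)
  refine ⟨fun u v w => (B.submoduleOf Z).mkQ (g u v w), ⟨?_, ?_, ?_, ?_, ?_⟩, ?_, ?_⟩
  · intro u w
    rw [show g u u w = 0 from Subtype.ext (edgeCochain_self u w), map_zero]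
  · intro u v w
    rw [show g u v w = g v u w from Subtype.ext (edgeCochain_symm u v w)]
  · intro u v
    rw [show g u v u = g u v v from Subtype.ext edgeCochain_end]
  · intro p q r hpq hpr hqr
    rw [← map_add, ← map_add, Submodule.mkQ_apply, Submodule.Quotient.mk_eq_zero]
    change edgeCochain p q r + edgeCochain p r q + edgeCochain q r p ∈ B
    rw [← differential_triple ν hpq hpr hqr]
    refine hcob _ ?_
    have h : ∀ z : Fin n, (if z = p ∨ z = q ∨ z = r then 1 else 2) +
      ((if z = p then 1 else 0) + (if z = q then 1 else 0) + (if z = r then 1 else 0)) = 2 := by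
      grind
    have := Finset.sum_congr (s₁ := Finset.univ) rfl fun z _ => h z
    simp only [Finset.sum_add_distrib, Finset.sum_ite_eq', Finset.mem_univ, if_true,
      Finset.sum_const, Finset.card_univ, Fintype.card_fin, smul_eq_mul] at this
    omega
  · intro u v huv
    rw [← map_sum, Submodule.mkQ_apply, Submodule.Quotient.mk_eq_zero]
    change ((∑ w, g u w v : Z) : Cochain (KGraph n) ℤ (TruncPoly 3) 1) ∈ B
    rw [Submodule.coe_sum, ← differential_pair ν huv]
    refine hcob _ ?_
    have h : ∀ z : Fin n, (if z = u then 0 else if z = v then 1 else 2) +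
      ((if z = u then 2 else 0) + (if z = v then 1 else 0)) = 2 := by
      grind
    have := Finset.sum_congr (s₁ := Finset.univ) rfl fun z _ => h z
    simp only [Finset.sum_add_distrib, Finset.sum_ite_eq', Finset.mem_univ, if_true,
      Finset.sum_const, Finset.card_univ, Fintype.card_fin, smul_eq_mul] at this
    omega
  · intro N hN
    rw [eq_top_iff]
    intro x _
    obtain ⟨⟨x, hx⟩, rfl⟩ := Submodule.mkQ_surjective _ x
    have hx' := hx.1
    rw [hgr] at hx'
    -- Transporting `N` to the cochains permits induction over the span of the generators.
    let N' : AddSubgroup (Cochain (KGraph n) ℤ (TruncPoly 3) 1) :=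
      (N.comap (B.submoduleOf Z).mkQ.toAddMonoidHom).map Z.subtype.toAddMonoidHom
    have hN' : x ∈ N' := by
      refine Submodule.span_induction (p := fun x _ => x ∈ N') ?_ N'.zero_mem
        (fun _ _ _ _ => N'.add_mem) (fun r y _ hy => ?_) hx'
      · rintro _ ⟨u, v, w, rfl⟩
        exact ⟨g u v w, hN u v w, rfl⟩
      · convert N'.zsmul_mem hy r using 1
    obtain ⟨z, hz, hzx⟩ := hN'
    obtain rfl : z = ⟨x, hx⟩ := Subtype.ext hzx
    exact hz
  · intro A _ φ hφ
    obtain ⟨Φ, hΦ⟩ := exists_linearMap_edgeCochain φ hφ.self hφ.symm hφ.ends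
    -- Coboundaries are spanned by differentials of monomials; the nonzero ones are of the two types
    -- covered by the relations.
    have hker : B.submoduleOf Z ≤ LinearMap.ker (Φ ∘ₗ Z.subtype) := by
      rw [LinearMap.ker_comp]
      refine Submodule.comap_mono ?_
      refine Submodule.map_le_iff_le_comap.2 ((gradedCochain_zero_le _).trans
        (Submodule.span_le.2 ?_))
      rintro _ ⟨f, hf, rfl⟩
      change Φ (differential ℤ (TruncPoly 3) ν 0 (vertexCochain f)) = 0
      by_cases hf3 : ∀ v, f v < 3
      · rcases exists_of_sum_eq hf3 (by omega) with
          ⟨p, q, r, hpq, hpr, hqr, rfl⟩ | ⟨u, v, huv, rfl⟩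
        · rw [differential_triple ν hpq hpr hqr, map_add, map_add, hΦ, hΦ, hΦ]
          exact hφ.triple p q r hpq hpr hqr
        · rw [differential_pair ν huv, map_sum, Finset.sum_congr rfl fun w _ => hΦ u w v]
          exact hφ.pair u v huv
      · push Not at hf3
        obtain ⟨v, hv⟩ := hf3
        rw [show vertexCochain f = 0 from funext fun s => vertexMono_eq_zero s.1 hv, map_zero,
          map_zero]
    refine ⟨((B.submoduleOf Z).liftQ _ hker).toAddMonoidHom, fun u v w => ?_⟩
    exact hΦ u v w

end Relations

/-! ### Consequences of the relations: torsion and generators -/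

section Presentation

variable {A : Type} [AddCommGroup A]

/-- The sum of the classes of the edges at `u`, with `x` at the component of the edge. -/
def starSum {n : ℕ} (φ : Fin n → Fin n → Fin n → A) (u : Fin n) : A := ∑ v, φ u v u

/-- For an edge avoiding the vertex `0`: the difference of the classes with `x` at the component of
the edge and at `0`. -/
def baseDiff {m : ℕ} (φ : Fin (m + 1) → Fin (m + 1) → Fin (m + 1) → A) (a b : Fin m) : A :=
  φ a.succ b.succ a.succ - φ a.succ b.succ 0

/-- The sum of the `baseDiff`s over the edges avoiding the vertices `0` and `1`. -/
def baseDiffSum {k : ℕ} (φ : Fin (k + 2) → Fin (k + 2) → Fin (k + 2) → A) : A :=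
  ∑ u : Fin k, ∑ v : Fin k, if u < v then baseDiff φ u.succ v.succ else 0

theorem sum_lt_add_sum_lt {k : ℕ} {f : Fin k → Fin k → A} (hself : ∀ u, f u u = 0)
    (hsymm : ∀ u v, f u v = f v u) :
    (∑ u, ∑ v, if u < v then f u v else 0) + (∑ u, ∑ v, if u < v then f u v else 0) =
      ∑ u, ∑ v, f u v := by
  nth_rw 2 [Finset.sum_comm]
  simp only [← Finset.sum_add_distrib]
  refine Finset.sum_congr rfl fun u _ => Finset.sum_congr rfl fun v _ => ?_
  rcases lt_trichotomy u v with h | rfl | h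
  · simp [h, h.not_gt]
  · simp [hself]
  · simp [h, h.not_gt, hsymm u v]

namespace EdgeRelations

section

variable {n : ℕ} {φ : Fin n → Fin n → Fin n → A} (hφ : EdgeRelations φ)
include hφ

/-- Sum the triple relation over ordered pairs `(v, w)` of distinct vertices other than `u`. By the
pair relations, each of its three terms contributes `-starSum φ u`. -/
theorem three_starSum (u : Fin n) : starSum φ u + starSum φ u + starSum φ u = 0 := by
  let D (v w : Fin n) : Prop := v ≠ w ∧ v ≠ u ∧ w ≠ u
  have h1 : ∑ v, ∑ w, (if D v w then φ u w v else 0) = -starSum φ u := by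
    rw [eq_neg_iff_add_eq_zero, starSum, ← Finset.sum_add_distrib]
    refine Finset.sum_eq_zero fun v _ => ?_
    by_cases hv : u = v
    · subst hv
      simp [D, hφ.self]
    · refine Eq.trans ?_ (hφ.pair u v hv)
      rw [← Finset.sum_erase_add _ _ (Finset.mem_univ v),
        ← Finset.sum_erase_add (f := fun w => φ u w v) _ (Finset.mem_univ v)]
      rw [if_neg (by simp [D]), add_zero, hφ.ends]
      congr 1
      refine Finset.sum_congr rfl fun w hw => ?_
      by_cases hw' : w = u
      · subst hw'
        simp [D, hφ.self]
      · exact if_pos ⟨(Finset.ne_of_mem_erase hw).symm, Ne.symm hv, hw'⟩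
  have h2 : ∑ v, ∑ w, (if D v w then φ v w u else 0) = -starSum φ u := by
    rw [eq_neg_iff_add_eq_zero, starSum, ← Finset.sum_add_distrib]
    refine Finset.sum_eq_zero fun v _ => ?_
    by_cases hv : v = u
    · subst hv
      simp [D, hφ.self]
    · refine Eq.trans ?_ (hφ.pair v u hv)
      rw [← Finset.sum_erase_add _ _ (Finset.mem_univ u),
        ← Finset.sum_erase_add (f := fun w => φ v w u) _ (Finset.mem_univ u)]
      rw [if_neg (by simp [D]), add_zero, hφ.symm u v u]
      congr 1
      refine Finset.sum_congr rfl fun w hw => ?_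
      by_cases hw' : w = v
      · subst hw'
        simp [D, hφ.self]
      · exact if_pos ⟨Ne.symm hw', hv, Finset.ne_of_mem_erase hw⟩
  -- This is the first sum with `v` and `w` interchanged.
  have h3 : ∑ v, ∑ w, (if D v w then φ u v w else 0) = -starSum φ u := by
    rw [Finset.sum_comm, ← h1]
    refine Finset.sum_congr rfl fun v _ => Finset.sum_congr rfl fun w _ => if_congr ?_ rfl rfl
    simp only [D]
    tauto
  have h : (∑ v, ∑ w, (if D v w then φ u v w else 0)) +
      (∑ v, ∑ w, (if D v w then φ u w v else 0)) +
      (∑ v, ∑ w, (if D v w then φ v w u else 0)) = 0 := by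
    simp only [← Finset.sum_add_distrib]
    refine Finset.sum_eq_zero fun v _ => Finset.sum_eq_zero fun w _ => ?_
    split_ifs with hD
    · exact hφ.triple u v w hD.2.1.symm hD.2.2.symm hD.1
    · simp
  rw [h1, h2, h3] at h
  rw [← neg_eq_zero, ← h]
  abel

end

section

variable {m : ℕ} {φ : Fin (m + 1) → Fin (m + 1) → Fin (m + 1) → A} (hφ : EdgeRelations φ)
include hφ

theorem baseDiff_self (a : Fin m) : baseDiff φ a a = 0 := by
  simp [baseDiff, hφ.self]

theorem baseDiff_symm (a b : Fin m) : baseDiff φ a b = baseDiff φ b a := by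
  rw [baseDiff, baseDiff, hφ.symm b.succ, hφ.symm b.succ, hφ.ends]

/-- The pair relation at `(a, 0)` turns the subtracted terms into `φ a 0 0`, the missing summand of
the star. -/
theorem sum_baseDiff (a : Fin m) : ∑ b, baseDiff φ a b = starSum φ a.succ := by
  have h := hφ.pair a.succ 0 (Fin.succ_ne_zero a)
  rw [Fin.sum_univ_succ] at h
  simp only [baseDiff, Finset.sum_sub_distrib, starSum, Fin.sum_univ_succ, hφ.ends a.succ 0]
  rw [eq_neg_of_add_eq_zero_left h]
  abel

/-- Subtract the triple relation on `0, a, b` from the pair relation at `(a, b)`; the common term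
cancels. This eliminates the edges at `0`. -/
theorem zero_edge {a b : Fin m} (hab : a ≠ b) :
    φ 0 b.succ a.succ = baseDiff φ a b + ∑ c, if c = b then 0 else φ a.succ c.succ b.succ := by
  have h := hφ.pair a.succ b.succ (by simpa using hab)
  have ht := hφ.triple 0 a.succ b.succ (Fin.succ_ne_zero _).symm (Fin.succ_ne_zero _).symm
    (by simpa using hab)
  have hs : ∑ c : Fin m, φ a.succ c.succ b.succ =
      (∑ c, if c = b then 0 else φ a.succ c.succ b.succ) + φ a.succ b.succ b.succ := by
    rw [← Finset.sum_erase_add _ _ (Finset.mem_univ b), ← Finset.sum_erase_add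
      (f := fun c => if c = b then 0 else φ a.succ c.succ b.succ) _ (Finset.mem_univ b),
      if_pos rfl, add_zero]
    congr 1
    exact Finset.sum_congr rfl fun c hc => (if_neg (Finset.ne_of_mem_erase hc)).symm
  rw [Fin.sum_univ_succ, hs, hφ.symm a.succ 0] at h
  rw [baseDiff, hφ.ends]
  generalize (∑ c, if c = b then 0 else φ a.succ c.succ b.succ) = S at *
  rw [← sub_eq_zero, ← neg_eq_zero, ← sub_eq_zero.2 (h.trans ht.symm)]
  abel

theorem mem_of_baseDiff_mem (N : AddSubgroup A) (hβ : ∀ a b, baseDiff φ a b ∈ N)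
    (ht : ∀ a b c : Fin m, a ≠ b → a ≠ c → b ≠ c → φ a.succ b.succ c.succ ∈ N)
    (u v w : Fin (m + 1)) : φ u v w ∈ N := by
  have h0 : ∀ a b : Fin m, a ≠ b → φ 0 b.succ a.succ ∈ N := by
    intro a b hab
    rw [hφ.zero_edge hab]
    refine N.add_mem (hβ a b) (N.sum_mem fun c _ => ?_)
    split_ifs with hcb
    · exact N.zero_mem
    · by_cases hca : a = c
      · rw [hca, hφ.self]
        exact N.zero_mem
      · exact ht a c b hca hab hcb
  have h1 : ∀ a b : Fin m, φ a.succ b.succ 0 ∈ N := by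
    intro a b
    by_cases hab : a = b
    · rw [hab, hφ.self]
      exact N.zero_mem
    · have := hφ.triple 0 a.succ b.succ (Fin.succ_ne_zero _).symm (Fin.succ_ne_zero _).symm
        (by simpa using hab)
      rw [eq_neg_of_add_eq_zero_right this]
      exact N.neg_mem (N.add_mem (h0 _ _ (Ne.symm hab)) (h0 _ _ hab))
  have h2 : ∀ a b : Fin m, φ a.succ b.succ a.succ ∈ N := by
    intro a b
    have := N.add_mem (hβ a b) (h1 a b)
    rwa [baseDiff, sub_add_cancel] at this
  have h3 : ∀ a : Fin m, φ a.succ 0 0 ∈ N := by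
    intro a
    have h := hφ.pair a.succ 0 (Fin.succ_ne_zero a)
    rw [Fin.sum_univ_succ] at h
    rw [eq_neg_of_add_eq_zero_left h]
    exact N.neg_mem (N.sum_mem fun b _ => h1 a b)
  have h4 : ∀ (a : Fin m) w, φ 0 a.succ w ∈ N := by
    intro a w
    cases w using Fin.cases with
    | zero =>
      rw [hφ.symm]
      exact h3 a
    | succ c =>
      by_cases hac : c = a
      · rw [hac, ← hφ.ends, hφ.symm]
        exact h3 a
      · exact h0 c a hac
  cases u using Fin.cases with
  | zero =>
    cases v using Fin.cases with
    | zero =>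
      rw [hφ.self]
      exact N.zero_mem
    | succ b => exact h4 b w
  | succ a =>
    cases v using Fin.cases with
    | zero =>
      rw [hφ.symm]
      exact h4 a w
    | succ b =>
      cases w using Fin.cases with
      | zero => exact h1 a b
      | succ c =>
        by_cases hab : a = b
        · rw [hab, hφ.self]
          exact N.zero_mem
        by_cases hac : a = c
        · rw [← hac]
          exact h2 a b
        by_cases hbc : b = c
        · rw [← hbc, ← hφ.ends]
          exact h2 a b
        exact ht a b c hab hac hbc

/-- The triple relation recovers the value with `x` at the largest of three vertices from the other
two. -/
theorem inner_mem (N : AddSubgroup A)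
    (hτ : ∀ x y r : Fin m, x ≠ y → x < r → y < r → φ y.succ r.succ x.succ ∈ N)
    (a b c : Fin m) (hab : a ≠ b) (hac : a ≠ c) (hbc : b ≠ c) : φ a.succ b.succ c.succ ∈ N := by
  by_cases h1 : a < b ∧ c < b
  · exact hτ c a b hac.symm h1.2 h1.1
  by_cases h2 : b < a ∧ c < a
  · rw [hφ.symm]
    exact hτ c b a hbc.symm h2.2 h2.1
  have h3 : a < c ∧ b < c := by omega
  have := hφ.triple a.succ b.succ c.succ (by simpa using hab) (by simpa using hac)
    (by simpa using hbc)
  rw [add_assoc] at this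
  rw [eq_neg_of_add_eq_zero_left this]
  exact N.neg_mem (N.add_mem (hτ b a c hab.symm h3.2 h3.1) (hτ a b c hab h3.1 h3.2))

end

section

variable {k : ℕ}

/-- Adding the stars at the vertices beyond `0` and `1` counts each edge among them twice and each
edge to `1` once; the latter edges add up to the star at `1`. -/
theorem two_baseDiffSum {φ : Fin (k + 2) → Fin (k + 2) → Fin (k + 2) → A} (hφ : EdgeRelations φ) :
    baseDiffSum φ + baseDiffSum φ = ∑ u : Fin k, starSum φ u.succ.succ - starSum φ (Fin.succ 0) := by
  rw [baseDiffSum, sum_lt_add_sum_lt (f := fun u v => baseDiff φ u.succ v.succ)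
    (fun u => hφ.baseDiff_self _) (fun u v => hφ.baseDiff_symm _ _)]
  simp only [← hφ.sum_baseDiff]
  simp only [Fin.sum_univ_succ (n := k), hφ.baseDiff_self, Finset.sum_add_distrib,
    hφ.baseDiff_symm (Fin.succ _) 0]
  abel

theorem six_baseDiffSum {φ : Fin (k + 2) → Fin (k + 2) → Fin (k + 2) → A} (hφ : EdgeRelations φ) :
    (6 : ℤ) • baseDiffSum φ = 0 := by
  have h3 : ∀ u, (3 : ℤ) • starSum φ u = 0 := fun u => by
    rw [← hφ.three_starSum u]
    abel
  have : (6 : ℤ) • baseDiffSum φ = (3 : ℤ) • (baseDiffSum φ + baseDiffSum φ) := by abel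
  rw [this, hφ.two_baseDiffSum, smul_sub, Finset.smul_sum, h3]
  simp [h3]

/-- The total sum recovers `baseDiff` on the omitted edge, then the star sums recover it on the
edges at the vertex `1`, and the inner values give the rest. -/
theorem mem_of_basis_mem {φ : Fin (k + 4) → Fin (k + 4) → Fin (k + 4) → A} (hφ : EdgeRelations φ)
    (N : AddSubgroup A) (hs : ∀ u : Fin (k + 2), starSum φ u.succ.succ ∈ N)
    (hε : baseDiffSum φ ∈ N)
    (hβ : ∀ u v : Fin (k + 2), u < v → v ≠ 1 → baseDiff φ u.succ v.succ ∈ N)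
    (hτ : ∀ x y r : Fin (k + 3), x ≠ y → x < r → y < r → φ y.succ r.succ x.succ ∈ N)
    (u v w : Fin (k + 4)) : φ u v w ∈ N := by
  -- For `u < v`, the condition `v ≠ 1` excludes only `(0, 1)`, which is the edge joining the
  -- vertices `2` and `3` of the graph.
  have h01 : baseDiff φ (Fin.succ (0 : Fin (k + 2))) (Fin.succ 1) ∈ N := by
    have hsplit : baseDiffSum φ = baseDiff φ (Fin.succ (0 : Fin (k + 2))) (Fin.succ 1) +
        ∑ u : Fin (k + 2), ∑ v : Fin (k + 2),
          if u < v ∧ v ≠ 1 then baseDiff φ u.succ v.succ else 0 := by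
      have : baseDiff φ (Fin.succ (0 : Fin (k + 2))) (Fin.succ 1) =
          ∑ u : Fin (k + 2), ∑ v : Fin (k + 2),
            if u = 0 then if v = 1 then baseDiff φ u.succ v.succ else 0 else 0 := by
        rw [Finset.sum_eq_single 0, Finset.sum_eq_single 1] <;> simp +contextual
      rw [this, baseDiffSum]
      simp only [← Finset.sum_add_distrib]
      refine Finset.sum_congr rfl fun u _ => Finset.sum_congr rfl fun v _ => ?_
      by_cases hv : v = 1
      · subst hv
        by_cases hu : u = 0
        · subst hu
          simp
        · have : ¬ u < 1 := by simpa [Fin.lt_one_iff] using hu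
          simp [hu, this]
      · simp [hv]
    rw [hsplit] at hε
    refine (N.add_mem_cancel_right (N.sum_mem fun u _ => N.sum_mem fun v _ => ?_)).1 hε
    split_ifs with h
    · exact hβ u v h.1 h.2
    · exact N.zero_mem
  have hlt : ∀ u v : Fin (k + 2), u < v → baseDiff φ u.succ v.succ ∈ N := by
    intro u v huv
    by_cases hv : v = 1
    · subst hv
      obtain rfl : u = 0 := by simpa [Fin.lt_one_iff] using huv
      exact h01
    · exact hβ u v huv hv
  have hss : ∀ u v : Fin (k + 2), baseDiff φ u.succ v.succ ∈ N := by
    intro u v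
    rcases lt_trichotomy u v with h | rfl | h
    · exact hlt u v h
    · rw [hφ.baseDiff_self]
      exact N.zero_mem
    · rw [hφ.baseDiff_symm]
      exact hlt v u h
  have hs0 : ∀ u : Fin (k + 2), baseDiff φ u.succ 0 ∈ N := by
    intro u
    have := hφ.sum_baseDiff u.succ
    rw [Fin.sum_univ_succ] at this
    rw [eq_sub_of_add_eq this]
    exact N.sub_mem (hs u) (N.sum_mem fun v _ => hss u v)
  refine hφ.mem_of_baseDiff_mem N ?_ (hφ.inner_mem N hτ) u v w
  intro a b
  cases a using Fin.cases with
  | zero =>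
    cases b using Fin.cases with
    | zero =>
      rw [hφ.baseDiff_self]
      exact N.zero_mem
    | succ b =>
      rw [hφ.baseDiff_symm]
      exact hs0 b
  | succ a =>
    cases b using Fin.cases with
    | zero => exact hs0 a
    | succ b => exact hss a b

end

end EdgeRelations

end Presentation

/-! ### Extending reduced data to a solution of all relations -/

section Construction

variable {A : Type} [AddCommGroup A] {m : ℕ}

/-- Data from which a function with `EdgeRelations` can be built. -/
structure EdgeData (β : Fin m → Fin m → A) (t : Fin m → Fin m → Fin m → A) : Prop where
  base_self : ∀ a, β a a = 0
  base_symm : ∀ a b, β a b = β b a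
  three_sum : ∀ a, ∑ b, β a b + ∑ b, β a b + ∑ b, β a b = 0
  inner_self : ∀ a b, t a a b = 0
  inner_self' : ∀ a b, t a b b = 0
  inner_symm : ∀ a b c, t a b c = t a c b
  inner_sum : ∀ a b c, t a b c + t b a c + t c a b = 0

/-- The value on the edge from `0` to `b`, with `x` at `a`. -/
def spoke (β : Fin m → Fin m → A) (t : Fin m → Fin m → Fin m → A) (a b : Fin m) : A :=
  β a b + ∑ c, t b a c

/-- The values on the edge from `0` to `b`. -/
def spokeFun (β : Fin m → Fin m → A) (t : Fin m → Fin m → Fin m → A) (b : Fin m) :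
    Fin (m + 1) → A :=
  Fin.cases (-∑ c, spoke β t b c) fun a => if a = b then -∑ c, spoke β t b c else spoke β t a b

/-- The function on edges and vertices given by `EdgeData`. -/
def edgeFun (β : Fin m → Fin m → A) (t : Fin m → Fin m → Fin m → A) :
    Fin (m + 1) → Fin (m + 1) → Fin (m + 1) → A :=
  Fin.cases (Fin.cases 0 (spokeFun β t)) fun a => Fin.cases (spokeFun β t a) fun b =>
    Fin.cases (-(spoke β t a b + spoke β t b a)) fun c =>
      if c = a ∨ c = b then β a b - (spoke β t a b + spoke β t b a) else t c a b

section

variable (β : Fin m → Fin m → A) (t : Fin m → Fin m → Fin m → A)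

theorem spokeFun_zero (b : Fin m) : spokeFun β t b 0 = -∑ c, spoke β t b c := rfl

theorem spokeFun_succ (a b : Fin m) : spokeFun β t b a.succ =
    if a = b then -∑ c, spoke β t b c else spoke β t a b := rfl

theorem edgeFun_zero_zero : edgeFun β t 0 0 = 0 := rfl

theorem edgeFun_zero_succ (b : Fin m) : edgeFun β t 0 b.succ = spokeFun β t b := rfl

theorem edgeFun_succ_zero (a : Fin m) : edgeFun β t a.succ 0 = spokeFun β t a := rfl

theorem edgeFun_succ_succ_zero (a b : Fin m) :
    edgeFun β t a.succ b.succ 0 = -(spoke β t a b + spoke β t b a) := rfl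

theorem edgeFun_succ_succ_succ (a b c : Fin m) : edgeFun β t a.succ b.succ c.succ =
    if c = a ∨ c = b then β a b - (spoke β t a b + spoke β t b a) else t c a b := rfl

end

variable {β : Fin m → Fin m → A} {t : Fin m → Fin m → Fin m → A}

theorem baseDiff_edgeFun (a b : Fin m) : baseDiff (edgeFun β t) a b = β a b := by
  rw [baseDiff, edgeFun_succ_succ_succ, edgeFun_succ_succ_zero, if_pos (Or.inl rfl)]
  abel

namespace EdgeData

variable (h : EdgeData β t)
include h

theorem spoke_self (a : Fin m) : spoke β t a a = 0 := by
  simp [spoke, h.base_self, h.inner_self]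

theorem inner_self_right (a b : Fin m) : t a b a = 0 := by
  rw [h.inner_symm, h.inner_self]

/-- The `β` terms make up three times a row sum. After one interchange of summation, the inner terms
group into relations `inner_sum`. -/
theorem three_sum_spoke (a : Fin m) :
    ∑ c, spoke β t a c + ∑ c, (spoke β t a c + spoke β t c a) = 0 := by
  have h1 : ∑ c, (t a c c + t c a c) = 0 := by
    simp [h.inner_self', h.inner_self_right]
  have h2 : ∑ c, ∑ d, t c a d + ∑ c, ∑ d, t c a d + ∑ c, ∑ d, t a c d = 0 := by
    nth_rw 2 [Finset.sum_comm]
    simp only [← Finset.sum_add_distrib]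
    refine Finset.sum_eq_zero fun c _ => Finset.sum_eq_zero fun d _ => ?_
    rw [← h.inner_sum a c d]
    abel
  have h3 := h.three_sum a
  simp only [spoke, Finset.sum_add_distrib, h.base_symm _ a]
  rw [← add_zero (0 : A)]
  nth_rw 1 [← h3]
  rw [← h2]
  abel

/-- All values involving `0` were chosen by solving relations, so most cases hold by construction.
The pair relation at `(u, 0)` was not used for this; it is `three_sum_spoke`. -/
theorem edgeRelations : EdgeRelations (edgeFun β t) where
  self u w := by
    cases u using Fin.cases with
    | zero => rfl
    | succ a =>
      cases w using Fin.cases with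
      | zero => simp [edgeFun_succ_succ_zero, h.spoke_self]
      | succ c => simp [edgeFun_succ_succ_succ, h.spoke_self, h.base_self, h.inner_self']
  symm u v w := by
    cases u using Fin.cases with
    | zero => cases v using Fin.cases <;> rfl
    | succ a =>
      cases v using Fin.cases with
      | zero => rfl
      | succ b =>
        cases w using Fin.cases with
        | zero => rw [edgeFun_succ_succ_zero, edgeFun_succ_succ_zero, add_comm]
        | succ c =>
          rw [edgeFun_succ_succ_succ, edgeFun_succ_succ_succ, add_comm, h.base_symm,
            h.inner_symm c a b]
          exact if_congr or_comm rfl rfl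
  ends u v := by
    cases u using Fin.cases with
    | zero =>
      cases v using Fin.cases with
      | zero => rfl
      | succ b => rw [edgeFun_zero_succ, spokeFun_zero, spokeFun_succ, if_pos rfl]
    | succ a =>
      cases v using Fin.cases with
      | zero => rw [edgeFun_succ_zero, spokeFun_zero, spokeFun_succ, if_pos rfl]
      | succ b => simp [edgeFun_succ_succ_succ]
  triple p q r hpq hpr hqr := by
    cases p using Fin.cases with
    | zero =>
      obtain ⟨q, rfl⟩ := Fin.exists_succ_eq.2 hpq.symm
      obtain ⟨r, rfl⟩ := Fin.exists_succ_eq.2 hpr.symm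
      have hqr' : q ≠ r := by simpa using hqr
      rw [edgeFun_zero_succ, edgeFun_zero_succ, edgeFun_succ_succ_zero, spokeFun_succ,
        spokeFun_succ, if_neg hqr', if_neg hqr'.symm]
      abel
    | succ p =>
      cases q using Fin.cases with
      | zero =>
        obtain ⟨r, rfl⟩ := Fin.exists_succ_eq.2 hqr.symm
        have hpr' : p ≠ r := by simpa using hpr
        rw [edgeFun_zero_succ, edgeFun_succ_zero, edgeFun_succ_succ_zero, spokeFun_succ,
          spokeFun_succ, if_neg hpr', if_neg hpr'.symm]
        abel
      | succ q =>
        have hpq' : p ≠ q := by simpa using hpq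
        cases r using Fin.cases with
        | zero =>
          rw [edgeFun_succ_zero, edgeFun_succ_zero, edgeFun_succ_succ_zero, spokeFun_succ,
            spokeFun_succ, if_neg hpq', if_neg hpq'.symm]
          abel
        | succ r =>
          have hpr' : p ≠ r := by simpa using hpr
          have hqr' : q ≠ r := by simpa using hqr
          rw [edgeFun_succ_succ_succ, edgeFun_succ_succ_succ, edgeFun_succ_succ_succ,
            if_neg (by tauto), if_neg (by tauto), if_neg (by tauto), ← h.inner_sum p q r]
          abel
  pair u v huv := by
    rw [Fin.sum_univ_succ]
    cases u using Fin.cases with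
    | zero =>
      obtain ⟨v, rfl⟩ := Fin.exists_succ_eq.2 huv.symm
      simp only [edgeFun_zero_zero, edgeFun_zero_succ, spokeFun_succ, Pi.zero_apply]
      rw [zero_add, ← Finset.add_sum_erase _ _ (Finset.mem_univ v), if_pos rfl, neg_add_eq_zero,
        ← Finset.add_sum_erase _ _ (Finset.mem_univ v), h.spoke_self, zero_add]
      exact Finset.sum_congr rfl fun w hw => (if_neg (Finset.ne_of_mem_erase hw).symm).symm
    | succ u =>
      cases v using Fin.cases with
      | zero =>
        simp only [edgeFun_succ_zero, edgeFun_succ_succ_zero, spokeFun_zero]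
        rw [Finset.sum_neg_distrib, ← neg_add, h.three_sum_spoke, neg_zero]
      | succ v =>
        have huv' : u ≠ v := by simpa using huv
        simp only [edgeFun_succ_zero, edgeFun_succ_succ_succ, spokeFun_succ]
        rw [if_neg huv'.symm, ← Finset.add_sum_erase _ _ (Finset.mem_univ v), if_pos (by tauto),
          Finset.sum_congr rfl fun w hw =>
            if_neg (by have := Finset.ne_of_mem_erase hw; tauto)]
        have hs : spoke β t u v = β u v + ∑ w ∈ Finset.univ.erase v, t v u w := by
          rw [spoke, ← Finset.add_sum_erase _ _ (Finset.mem_univ v), h.inner_self_right, zero_add]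
        rw [hs]
        abel

end EdgeData

end Construction

/-! ### Independent coordinates and their number -/

section FreeData

variable {A : Type} [AddCommGroup A]

/-- The differences `baseDiff` in terms of their sums over the edges at a vertex, their total sum
and free values `e` on the remaining edges: the values on edges between vertices other than
`0`, `1`. -/
def pairFun {k : ℕ} (ε : A) (e : Fin (k + 2) → Fin (k + 2) → A) (u v : Fin (k + 2)) : A :=
  (if u < v ∧ v ≠ 1 then e u v else 0) + (if v < u ∧ u ≠ 1 then e v u else 0) +
    if u = 0 ∧ v = 1 ∨ u = 1 ∧ v = 0 then
      ε - ∑ a, ∑ b, (if a < b ∧ b ≠ 1 then e a b else 0) else 0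

/-- The values of `baseDiff` on all edges avoiding the vertex `0`. -/
def baseFun {k : ℕ} (δ : Fin (k + 2) → A) (ε : A) (e : Fin (k + 2) → Fin (k + 2) → A) :
    Fin (k + 3) → Fin (k + 3) → A :=
  Fin.cases (Fin.cases 0 fun v => δ v - ∑ w, pairFun ε e v w) fun u =>
    Fin.cases (δ u - ∑ w, pairFun ε e u w) fun v => pairFun ε e u v

/-- The values on an edge avoiding `0` and a vertex off this edge, in terms of those where this
vertex is not the largest of the three. -/
def innerFun {m : ℕ} (τ : Fin m → Fin m → Fin m → A) (a b c : Fin m) : A :=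
  if a ≠ b ∧ a ≠ c ∧ b ≠ c then
    if a < c ∧ b < c then τ a b c else if a < b ∧ c < b then τ a c b else -(τ b c a + τ c b a)
  else 0

section

variable {k : ℕ} (δ : Fin (k + 2) → A) (ε : A) (e : Fin (k + 2) → Fin (k + 2) → A)

theorem baseFun_zero_zero : baseFun δ ε e 0 0 = 0 := rfl

theorem baseFun_zero_succ (v : Fin (k + 2)) :
    baseFun δ ε e 0 v.succ = δ v - ∑ w, pairFun ε e v w := rfl

theorem baseFun_succ_zero (v : Fin (k + 2)) :
    baseFun δ ε e v.succ 0 = δ v - ∑ w, pairFun ε e v w := rfl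

theorem baseFun_succ_succ (u v : Fin (k + 2)) :
    baseFun δ ε e u.succ v.succ = pairFun ε e u v := rfl

theorem pairFun_self (u : Fin (k + 2)) : pairFun ε e u u = 0 := by
  rw [pairFun, if_neg (by simp), if_neg, add_zero, add_zero]
  rintro (⟨rfl, h⟩ | ⟨rfl, h⟩) <;> simp at h

theorem pairFun_symm (u v : Fin (k + 2)) : pairFun ε e u v = pairFun ε e v u := by
  rw [pairFun, pairFun, add_comm (if u < v ∧ v ≠ 1 then e u v else 0)]
  congr 1
  exact if_congr (by tauto) rfl rfl

theorem pairFun_of_lt {u v : Fin (k + 2)} (huv : u < v) (hv : v ≠ 1) :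
    pairFun ε e u v = e u v := by
  rw [pairFun, if_pos ⟨huv, hv⟩, if_neg (by simp [huv.not_gt]), if_neg, add_zero, add_zero]
  rintro (⟨-, h⟩ | ⟨-, h⟩)
  · exact hv h
  · subst h
    exact absurd huv (Fin.not_lt_zero _)

theorem sum_lt_pairFun :
    (∑ u, ∑ v, if u < v then pairFun ε e u v else 0) = ε := by
  have h : ∀ u v : Fin (k + 2), (if u < v then pairFun ε e u v else 0) =
      (if u < v ∧ v ≠ 1 then e u v else 0) + if u = 0 then if v = 1 then
        ε - ∑ a, ∑ b, (if a < b ∧ b ≠ 1 then e a b else 0) else 0 else 0 := by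
    intro u v
    by_cases huv : u < v
    · rw [if_pos huv, pairFun, if_neg (c := v < u ∧ u ≠ 1) (by simp [huv.not_gt]), add_zero,
        ← ite_and]
      congr 1
      refine if_congr ⟨fun h => h.resolve_right ?_, Or.inl⟩ rfl rfl
      rintro ⟨-, rfl⟩
      exact absurd huv (Fin.not_lt_zero _)
    · rw [if_neg huv, if_neg (by simp [huv]), ← ite_and, if_neg, add_zero]
      rintro ⟨rfl, rfl⟩
      exact huv (by simp)
  simp only [h, Finset.sum_add_distrib]
  simp

theorem innerFun_of_lt {m : ℕ} (τ : Fin m → Fin m → Fin m → A) {x y r : Fin m} (hxy : x ≠ y)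
    (hx : x < r) (hy : y < r) : innerFun τ x y r = τ x y r := by
  rw [innerFun, if_pos ⟨hxy, hx.ne, hy.ne⟩, if_pos ⟨hx, hy⟩]

/-- The row sums of `baseFun` are `δ u` except in the row of the vertex `1`, where the sum is `∑ u,
δ u - 2ε`. Its triple vanishes precisely because of `hδ` and `6ε = 0`. -/
theorem edgeData_free (τ : Fin (k + 3) → Fin (k + 3) → Fin (k + 3) → A)
    (hδ : ∀ u, δ u + δ u + δ u = 0) (hε : (6 : ℤ) • ε = 0) :
    EdgeData (baseFun δ ε e) (innerFun τ) where
  base_self a := by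
    cases a using Fin.cases with
    | zero => rfl
    | succ a => exact pairFun_self _ _ _
  base_symm a b := by
    cases a using Fin.cases with
    | zero => cases b using Fin.cases <;> rfl
    | succ a =>
      cases b using Fin.cases with
      | zero => rfl
      | succ b => exact pairFun_symm _ _ _ _
  three_sum a := by
    cases a using Fin.cases with
    | zero =>
      have h2 := sum_lt_add_sum_lt (pairFun_self ε e) (pairFun_symm ε e)
      have h3 : ∑ u, δ u + ∑ u, δ u + ∑ u, δ u = 0 := by
        simp [← Finset.sum_add_distrib, hδ]
      rw [sum_lt_pairFun] at h2
      simp only [Fin.sum_univ_succ (n := k + 2), baseFun_zero_zero, baseFun_zero_succ,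
        Finset.sum_sub_distrib]
      rw [← h2]
      trans (∑ u, δ u + ∑ u, δ u + ∑ u, δ u) - (6 : ℤ) • ε
      · abel
      · rw [h3, hε, sub_zero]
    | succ u =>
      simp only [Fin.sum_univ_succ (n := k + 2), baseFun_succ_zero, baseFun_succ_succ,
        sub_add_cancel, hδ]
  inner_self a b := if_neg (by simp)
  inner_self' a b := if_neg (by simp)
  inner_symm a b c := by
    unfold innerFun
    split_ifs <;> first | (exfalso; omega) | abel
  inner_sum a b c := by
    unfold innerFun
    split_ifs <;> first | (exfalso; omega) | abel

theorem exists_edgeRelations (τ : Fin (k + 3) → Fin (k + 3) → Fin (k + 3) → A)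
    (hδ : ∀ u, δ u + δ u + δ u = 0) (hε : (6 : ℤ) • ε = 0) :
    ∃ φ : Fin (k + 4) → Fin (k + 4) → Fin (k + 4) → A, EdgeRelations φ ∧
      (∀ u : Fin (k + 2), starSum φ u.succ.succ = δ u) ∧ baseDiffSum φ = ε ∧
      (∀ u v : Fin (k + 2), u < v → v ≠ 1 → baseDiff φ u.succ v.succ = e u v) ∧
      ∀ x y r : Fin (k + 3), x ≠ y → x < r → y < r → φ y.succ r.succ x.succ = τ x y r := by
  have h := edgeData_free δ ε e τ hδ hε
  refine ⟨_, h.edgeRelations, fun u => ?_, ?_, fun u v huv hv => ?_, fun x y r hxy hx hy => ?_⟩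
  · rw [← h.edgeRelations.sum_baseDiff]
    simp only [baseDiff_edgeFun, Fin.sum_univ_succ (n := k + 2), baseFun_succ_zero,
      baseFun_succ_succ, sub_add_cancel]
  · simp only [baseDiffSum, baseDiff_edgeFun, baseFun_succ_succ]
    exact sum_lt_pairFun ε e
  · rw [baseDiff_edgeFun, baseFun_succ_succ, pairFun_of_lt ε e huv hv]
  · rw [edgeFun_succ_succ_succ, if_neg (by omega), innerFun_of_lt τ hxy hx hy]

end

/-- The free generators: the edges which avoid the vertices `0` and `1`, except the first one, and
the edges which avoid `0`, with a vertex other than `0` which is smaller than one of the ends. -/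
abbrev FreeIndex (k : ℕ) : Type :=
  {p : Fin (k + 2) × Fin (k + 2) // p.1 < p.2 ∧ p.2 ≠ 1} ⊕
    {p : Fin (k + 3) × Fin (k + 3) × Fin (k + 3) // p.1 ≠ p.2.1 ∧ p.1 < p.2.2 ∧ p.2.1 < p.2.2}

/-- The sum of cyclic groups with which the cohomology is identified. -/
abbrev CyclicSum (k : ℕ) : Type := ZMod 6 × (Fin (k + 2) → ZMod 3) × (FreeIndex k → ℤ)

theorem card_pairs (k : ℕ) :
    2 * (Fintype.card {p : Fin (k + 2) × Fin (k + 2) // p.1 < p.2 ∧ p.2 ≠ 1} + 1) =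
      (k + 2) * (k + 1) := by
  have h1 : Fintype.card {p : Fin (k + 2) × Fin (k + 2) // p.1 < p.2 ∧ p.2 ≠ 1} + 1 =
      ∑ r ∈ Finset.range (k + 2), r := by
    -- Restoring the omitted pair `(0, 1)` gives all pairs `u < v`, which are counted by their
    -- larger entry.
    rw [Fintype.card_subtype, ← Finset.card_insert_of_notMem (a := ((0 : Fin (k + 2)), 1)) (by simp)]
    rw [Finset.card_eq_sum_card_fiberwise (f := Prod.snd) (t := Finset.univ) (by simp),
      ← Fin.sum_univ_eq_sum_range (fun r => r)]
    refine Finset.sum_congr rfl fun r _ => ?_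
    rw [← Fin.card_Iio r]
    refine Finset.card_bij (fun p _ => p.1) ?_ ?_ ?_
    · rintro ⟨a, b⟩ h
      simp only [Finset.mem_filter, Finset.mem_insert, Finset.mem_univ, Prod.mk.injEq] at h
      obtain ⟨⟨rfl, rfl⟩ | h, rfl⟩ := h
      · simp
      · simpa using h.2.1
    · rintro ⟨a, b⟩ h ⟨a', b'⟩ h' rfl
      simp only [Finset.mem_filter] at h h'
      simp [h.2, h'.2]
    · intro a ha
      refine ⟨(a, r), ?_, rfl⟩
      simp only [Finset.mem_Iio] at ha
      simp only [Finset.mem_filter, Finset.mem_insert, Finset.mem_univ, Prod.mk.injEq, true_and,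
        and_true]
      by_cases hr : r = 1
      · subst hr
        exact Or.inl ⟨by simpa [Fin.lt_one_iff] using ha, rfl⟩
      · exact Or.inr ⟨ha, hr⟩
  rw [h1, mul_comm, Finset.sum_range_id_mul_two]
  rfl

theorem sum_mul_pred (m : ℕ) : 3 * ∑ r ∈ Finset.range (m + 2), r * (r - 1) = (m + 2) * (m + 1) * m := by
  induction m with
  | zero => simp [Finset.sum_range_succ]
  | succ m ih =>
    rw [Finset.sum_range_succ, mul_add, ih]
    simp only [Nat.add_succ_sub_one]
    ring

theorem card_triples (m : ℕ) :
    3 * Fintype.card {p : Fin (m + 2) × Fin (m + 2) × Fin (m + 2) //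
      p.1 ≠ p.2.1 ∧ p.1 < p.2.2 ∧ p.2.1 < p.2.2} = (m + 2) * (m + 1) * m := by
  rw [← sum_mul_pred, Fintype.card_subtype,
    Finset.card_eq_sum_card_fiberwise (f := fun p => p.2.2) (t := Finset.univ) (by simp),
    ← Fin.sum_univ_eq_sum_range (fun r => r * (r - 1))]
  congr 1
  refine Finset.sum_congr rfl fun r _ => ?_
  -- With the largest entry `r` fixed, what remains is an ordered pair of distinct entries below
  -- `r`.
  have : (r : ℕ) * (r - 1) = (Finset.Iio r).offDiag.card := by
    rw [Finset.offDiag_card, Fin.card_Iio, Nat.mul_sub, mul_one]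
  rw [this]
  refine Finset.card_bij (fun p _ => (p.1, p.2.1)) ?_ ?_ ?_
  · rintro ⟨a, b, c⟩ h
    simp only [Finset.mem_filter, Finset.mem_univ, true_and] at h
    obtain ⟨h, rfl⟩ := h
    simpa using ⟨h.2.1, h.2.2, h.1⟩
  · rintro ⟨a, b, c⟩ h ⟨a', b', c'⟩ h' hab
    simp only [Finset.mem_filter, Prod.mk.injEq] at h h' hab
    simp [h.2, h'.2, hab]
  · rintro ⟨a, b⟩ hab
    simp only [Finset.mem_offDiag, Finset.mem_Iio] at hab
    exact ⟨(a, b, r), by simpa using ⟨hab.2.2, hab.1, hab.2.1⟩, rfl⟩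

theorem card_freeIndex (k : ℕ) : Fintype.card (FreeIndex k) =
    (k + 4) * (k + 4 - 1) * (2 * (k + 4) - 7) / 6 := by
  have h1 := card_pairs k
  have h2 : 3 * Fintype.card {p : Fin (k + 3) × Fin (k + 3) × Fin (k + 3) //
      p.1 ≠ p.2.1 ∧ p.1 < p.2.2 ∧ p.2.1 < p.2.2} = (k + 3) * (k + 2) * (k + 1) :=
    card_triples (k + 1)
  rw [Fintype.card_sum]
  have h3 : 2 * (k + 4) - 7 = 2 * k + 1 := by omega
  have h4 : k + 4 - 1 = k + 3 := rfl
  rw [h3, h4]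
  symm
  refine Nat.div_eq_of_eq_mul_right (by norm_num) ?_
  nlinarith

end FreeData

/-! ### Identification with a sum of cyclic groups -/

section Main

variable {P : Type} [AddCommGroup P]

/-- Universality gives a map `Φ` taking the chosen generators to the standard ones of `CyclicSum k`.
These generate `P`, and their orders divide `6` and `3` where required, so a combination killed by
`Φ` is already zero. -/
theorem nonempty_addEquiv_of_presentation {k : ℕ} (γ : Fin (k + 4) → Fin (k + 4) → Fin (k + 4) → P)
    (hγ : EdgeRelations γ) (htop : ∀ N : AddSubgroup P, (∀ u v w, γ u v w ∈ N) → N = ⊤)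
    (huniv : ∀ (A : Type) [AddCommGroup A] (φ : Fin (k + 4) → Fin (k + 4) → Fin (k + 4) → A),
      EdgeRelations φ → ∃ Φ : P →+ A, ∀ u v w, Φ (γ u v w) = φ u v w) :
    Nonempty (P ≃+ CyclicSum k) := by
  classical
  let free (i : FreeIndex k) : CyclicSum k := (0, 0, Pi.single i 1)
  obtain ⟨φ, hφ, hs, hε, he, hτ⟩ := exists_edgeRelations (A := CyclicSum k) (k := k)
    (fun u => (0, Pi.single u 1, 0)) (1, 0, 0)
    (fun u v => if h : u < v ∧ v ≠ 1 then free (Sum.inl ⟨(u, v), h⟩) else 0)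
    (fun x y r => if h : x ≠ y ∧ x < r ∧ y < r then free (Sum.inr ⟨(x, y, r), h⟩) else 0)
    (fun u => by
      simp only [Prod.mk_add_mk, ← Pi.single_add, add_zero]
      rw [show (1 + 1 + 1 : ZMod 3) = 0 from rfl, Pi.single_zero]
      rfl)
    (by
      refine Prod.ext ?_ (smul_zero (6 : ℤ))
      change (6 : ℤ) • (1 : ZMod 6) = 0
      rw [zsmul_one]
      rfl)
  obtain ⟨Φ, hΦ⟩ := huniv _ φ hφ
  let genr : FreeIndex k → P := Sum.elim
    (fun p => baseDiff γ p.1.1.succ p.1.2.succ)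
    (fun p => γ p.1.2.1.succ p.1.2.2.succ p.1.1.succ)
  let θ (z : ℤ) (a : Fin (k + 2) → ℤ) (f : FreeIndex k → ℤ) : P :=
    z • baseDiffSum γ + ∑ u, a u • starSum γ u.succ.succ + ∑ i, f i • genr i
  have hΦs : ∀ u : Fin (k + 2), Φ (starSum γ u.succ.succ) = (0, Pi.single u 1, 0) := by
    intro u
    simp only [starSum, map_sum, hΦ]
    exact hs u
  have hΦβ : ∀ a b, Φ (baseDiff γ a b) = baseDiff φ a b := by
    intro a b
    simp only [baseDiff, map_sub, hΦ]
  have hΦε : Φ (baseDiffSum γ) = (1, 0, 0) := by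
    rw [← hε]
    simp only [baseDiffSum, map_sum, apply_ite Φ, hΦβ, map_zero]
  have hΦg : ∀ i, Φ (genr i) = free i := by
    rintro (⟨p, hp⟩ | ⟨p, hp⟩)
    · refine (hΦβ _ _).trans ((he _ _ hp.1 hp.2).trans (dif_pos hp))
    · refine (hΦ _ _ _).trans ((hτ _ _ _ hp.1 hp.2.1 hp.2.2).trans (dif_pos hp))
  have hΦθ : ∀ z a f, Φ (θ z a f) = ((z : ZMod 6), fun u => (a u : ZMod 3), f) := by
    intro z a f
    simp only [θ, map_add, map_sum, map_zsmul, hΦε, hΦs, hΦg, free]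
    refine Prod.ext ?_ (Prod.ext ?_ ?_)
    · simp [Prod.fst_sum, -Fintype.sum_sum_type]
    · funext v
      simp [Prod.fst_sum, Prod.snd_sum, Finset.sum_apply, Pi.single_apply, -Fintype.sum_sum_type]
    · funext v
      simp [Prod.snd_sum, Finset.sum_apply, Pi.single_apply, -Fintype.sum_sum_type]
  -- The combinations `θ` form a subgroup containing the chosen generators, so it is everything.
  let N : AddSubgroup P :=
    { carrier := {x | ∃ z a f, x = θ z a f}
      zero_mem' := ⟨0, 0, 0, by simp [θ]⟩
      add_mem' := by
        rintro _ _ ⟨z, a, f, rfl⟩ ⟨z', a', f', rfl⟩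
        refine ⟨z + z', a + a', f + f', ?_⟩
        simp only [θ, Pi.add_apply, add_smul, Finset.sum_add_distrib]
        abel
      neg_mem' := by
        rintro _ ⟨z, a, f, rfl⟩
        refine ⟨-z, -a, -f, ?_⟩
        simp only [θ, Pi.neg_apply, neg_smul, Finset.sum_neg_distrib]
        abel }
  have hg : ∀ i, genr i ∈ N := fun i =>
    ⟨0, 0, Pi.single i 1, by simp [θ, Pi.single_apply, ite_smul, -Fintype.sum_sum_type]⟩
  have hN : N = ⊤ := by
    refine htop N (hγ.mem_of_basis_mem N (fun u => ?_) ?_ (fun u v huv hv => ?_)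
      (fun x y r hxy hx hy => ?_))
    · exact ⟨0, Pi.single u 1, 0, by simp [θ, Pi.single_apply, ite_smul]⟩
    · exact ⟨1, 0, 0, by simp [θ]⟩
    · exact hg (Sum.inl ⟨(u, v), huv, hv⟩)
    · exact hg (Sum.inr ⟨(x, y, r), hxy, hx, hy⟩)
  refine ⟨AddEquiv.ofBijective Φ ⟨(injective_iff_map_eq_zero Φ).2 fun x hx => ?_, ?_⟩⟩
  · obtain ⟨z, a, f, rfl⟩ : x ∈ N := hN ▸ AddSubgroup.mem_top x
    rw [hΦθ, Prod.mk_eq_zero, Prod.mk_eq_zero] at hx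
    obtain ⟨hz, ha, rfl⟩ := hx
    obtain ⟨z, rfl⟩ := (ZMod.intCast_zmod_eq_zero_iff_dvd z 6).1 hz
    have ha' : ∀ u, ∃ c, a u = 3 * c := fun u =>
      (ZMod.intCast_zmod_eq_zero_iff_dvd (a u) 3).1 (congrFun ha u)
    have h3 : ∀ u, (3 : ℤ) • starSum γ u = 0 := fun u => by
      rw [← hγ.three_starSum u]
      abel
    simp only [θ, Pi.zero_apply, zero_smul, Finset.sum_const_zero, add_zero]
    rw [Finset.sum_eq_zero, add_zero]
    · rw [mul_comm, mul_smul]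
      exact (congrArg (z • ·) hγ.six_baseDiffSum).trans (smul_zero z)
    · intro u _
      obtain ⟨c, hc⟩ := ha' u
      rw [hc, mul_comm, mul_smul, h3, smul_zero]
  · rintro ⟨z, a, f⟩
    choose a' ha' using fun u => ZMod.intCast_surjective (a u)
    obtain ⟨z', rfl⟩ := ZMod.intCast_surjective z
    exact ⟨θ z' a' f, by rw [hΦθ, funext ha']⟩

end Main

end ChromaticCohomology
end

open ChromaticCohomology in
theorem corollary4p9 (n : ℕ) (hn : 4 ≤ n) (ν : (⊤ : SimpleGraph (Fin n)).edgeSet ↪ ℕ) :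
    Nonempty (Cohomology ν (truncPolyDegree 3) 1 (2 * n - 3) ≃+
      ZMod 2 × (Fin (n - 1) → ZMod 3) × (Fin (n * (n - 1) * (2 * n - 7) / 6) → ℤ)) := by
  obtain ⟨k, rfl⟩ := Nat.exists_eq_add_of_le' hn
  obtain ⟨γ, hγ, htop, huniv⟩ := exists_cohomology_generators ν (by omega)
  obtain ⟨e⟩ := nonempty_addEquiv_of_presentation γ hγ htop huniv
  -- The `ℤ_3` in `ℤ_6` joins the `k + 2 = n - 2` copies from the star sums to give `n - 1`.
  let e₆ : ZMod 6 ≃+ ZMod 2 × ZMod 3 :=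
    (ZMod.chineseRemainder (m := 2) (n := 3) (by norm_num)).toAddEquiv
  let e₃ : (ZMod 3 × (Fin (k + 2) → ZMod 3)) ≃+ (Fin (k + 3) → ZMod 3) :=
    { Fin.consEquiv (fun _ => ZMod 3) with
      map_add' := fun x y => by
        funext i
        cases i using Fin.cases <;> rfl }
  let eI : FreeIndex k ≃ Fin ((k + 4) * (k + 4 - 1) * (2 * (k + 4) - 7) / 6) :=
    Fintype.equivFinOfCardEq (card_freeIndex k)
  let eF : (FreeIndex k → ℤ) ≃+ (Fin ((k + 4) * (k + 4 - 1) * (2 * (k + 4) - 7) / 6) → ℤ) :=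
    (LinearEquiv.funCongrLeft ℤ ℤ eI.symm).toAddEquiv
  refine ⟨e.trans ((e₆.prodCongr (AddEquiv.refl _)).trans
    (AddEquiv.prodAssoc.trans ((AddEquiv.refl _).prodCongr
      (AddEquiv.prodAssoc.symm.trans (e₃.prodCongr eF)))))⟩
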